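/- Let $\mathcal M$ be a monoidal bicategory with tensor product written as juxtaposition and unit object $I$; composition of $1$-cells is written $gf$, and the constraint cells of $\mathcal M$ are suppressed in the notation. A right skew monoidale in $\mathcal M$ is an object $R$ with $1$-cells $m:RR\to R$ and $i:I\to R$ and $2$-cells, not necessarily invertible, $$\alpha: m(1m)\Rightarrow m(m1),\qquad \lambda: 1\Rightarrow m(i1),\qquad \rho: m(1i)\Rightarrow 1,$$ satisfying the following five axioms, in which we write $xy$ for the product and $u$ for the unit: the two composites $x(y(zw))\Rightarrow((xy)z)w$ built from $\alpha$ agree (pentagon); the composite $xy\Rightarrow x(uy)\Rightarrow(xu)y\Rightarrow xy$ is the identity (triangle); the composite $xy\Rightarrow u(xy)\Rightarrow(ux)y$ of $\lambda$ and $\alpha$ equals $\lambda$ at $x$; the composite $x(yu)\Rightarrow(xy)u\Rightarrow xy$ of $\alpha$ and $\rho$ equals $\rho$ at $y$; and the composite $u\Rightarrow uu\Rightarrow u$ is the identity. Given a right skew structure $(M,m,u,\alpha,\lambda,\rho)$ on an object $M$, an oplax right $M$-action on an object $A$ is a $1$-cell $a:AM\to A$ with $2$-cells $a^2:a(1m)\Rightarrow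 a(a1)$ and $a^0:a(1u)\Rightarrow 1$ satisfying the following three axioms, in which we write $xp$ for the action and $pq$ for the product of $M$: the two composites $x(p(qs))\Rightarrow((xp)q)s$ (one built from $a^2$ only, the other from $\alpha$ and $a^2$) agree; the composite $x(pu)\Rightarrow(xp)u\Rightarrow xp$ of $a^2$ and $a^0$ equals the one given by $\rho$ at $p$; and the composite $xp\Rightarrow x(up)\Rightarrow(xu)p\Rightarrow xp$ of $\lambda$, $a^2$ and $a^0$ is the identity. Every adjunction $i\dashv i^*$ with $i:I\to R$, unit $\eta:1\Rightarrow i^*i$ and counit $\varepsilon:ii^*\Rightarrow 1$ gives a right skew structure on $R$ with product $i^*1:RR\to R$, unit $i$, associator the constraint isomorphism $(i^*1)(1i^*1)\cong(i^*1)(i^*11)$, left unitor $\eta1:1\Rightarrow(i^*1)(i1)$, and right unitor $(i^*1)(1i)\cong ii^*\Rightarrow1$ given by $\varepsilon$. **Proposition.** Let $(R,i,m,\alpha,\lambda,\rho)$ be a right skew monoidale in $\mathcal M$ whose unit $i$ has a right adjoint, $i\dashv i^*$. Let $\kappa:i^*1\Rightarrow m$ be the mate of $\lambda$ under the adjunction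 $i1\dashv i^*1$. Then the $1$-cell $r:=m:RR\to R$, with unitor $r^0:=\rho:r(1i)\Rightarrow1$ and associator $$r^2:\; r(1i^*1)\xrightarrow{\;r(1\kappa)\;} r(1r)=m(1m)\xrightarrow{\;\alpha\;} m(m1)=r(r1),$$ is an oplax right $R$-action on $R$ with respect to the right skew structure on $R$ induced by $i\dashv i^*$ as above. -/

import Mathlib

open CategoryTheory Bicategory

universe w v u

namespace MonBicat

/-! ### Monoidal bicategories

Composition of 1-cells is written in diagrammatic order; the tensor product of objects, 1-cells and
2-cells is `X ⊠ Y`, `f ⊠₁ g`, `η ⊠₂ θ`. Associators and unitors of the bicategory itself that are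
needed only for re-bracketing composites of 1-cells are inserted by `⊗≫`. -/

/-- A bicategory with a tensor product pseudofunctor and a unit object. -/
class TensorBicategory (B : Type u) [Bicategory.{w, v} B] where
  tensor : (B × B) ⥤ᵖ B
  tensorUnit : B

section Tensor

variable {B : Type u} [Bicategory.{w, v} B] [TensorBicategory B]

def tensorObj (X Y : B) : B := (TensorBicategory.tensor (B := B)).obj (X, Y)

infixr:70 " ⊠ " => tensorObj

/-- The unit object `I`. -/
def tensorI (B : Type u) [Bicategory.{w, v} B] [TensorBicategory B] : B :=
  TensorBicategory.tensorUnit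

def tensorHom {X X' Y Y' : B} (f : X ⟶ X') (g : Y ⟶ Y') : X ⊠ Y ⟶ X' ⊠ Y' :=
  (TensorBicategory.tensor (B := B)).map (Prod.mkHom f g)

infixr:83 " ⊠₁ " => tensorHom

def tensorHom₂ {X X' Y Y' : B} {f f' : X ⟶ X'} {g g' : Y ⟶ Y'} (η : f ⟶ f') (θ : g ⟶ g') :
    f ⊠₁ g ⟶ f' ⊠₁ g' :=
  (TensorBicategory.tensor (B := B)).map₂ (Prod.mkHom η θ)

infixr:83 " ⊠₂ " => tensorHom₂

def tensorIso {X X' Y Y' : B} {f f' : X ⟶ X'} {g g' : Y ⟶ Y'} (e : f ≅ f') (e' : g ≅ g') :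
    f ⊠₁ g ≅ f' ⊠₁ g' :=
  (TensorBicategory.tensor (B := B)).map₂Iso (Iso.prod e e')

/-- The identity constraint of the tensor product. -/
def tensorId (X Y : B) : 𝟙 X ⊠₁ 𝟙 Y ≅ 𝟙 (X ⊠ Y) :=
  (TensorBicategory.tensor (B := B)).mapId (X, Y)

/-- The composition constraint of the tensor product. -/
def tensorComp {X X' X'' Y Y' Y'' : B} (f : X ⟶ X') (f' : X' ⟶ X'') (g : Y ⟶ Y') (g' : Y' ⟶ Y'') :
    (f ≫ f') ⊠₁ (g ≫ g') ≅ f ⊠₁ g ≫ f' ⊠₁ g' :=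
  (TensorBicategory.tensor (B := B)).mapComp (Prod.mkHom f g) (Prod.mkHom f' g')

/-- The canonical isomorphism `1(f ≫ g) ≅ 1f ≫ 1g`. -/
def lcomp (A : B) {X Y Z : B} (f : X ⟶ Y) (g : Y ⟶ Z) :
    𝟙 A ⊠₁ (f ≫ g) ≅ 𝟙 A ⊠₁ f ≫ 𝟙 A ⊠₁ g :=
  tensorIso (λ_ (𝟙 A)).symm (Iso.refl (f ≫ g)) ≪≫ tensorComp (𝟙 A) (𝟙 A) f g

/-- The canonical isomorphism `(f ≫ g)1 ≅ f1 ≫ g1`. -/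
def rcomp {X Y Z : B} (f : X ⟶ Y) (g : Y ⟶ Z) (A : B) :
    (f ≫ g) ⊠₁ 𝟙 A ≅ f ⊠₁ 𝟙 A ≫ g ⊠₁ 𝟙 A :=
  tensorIso (Iso.refl (f ≫ g)) (λ_ (𝟙 A)).symm ≪≫ tensorComp f g (𝟙 A) (𝟙 A)

/-- The interchange isomorphism `f1 ≫ 1g ≅ 1g ≫ f1`. -/
def interchange {X X' Y Y' : B} (f : X ⟶ X') (g : Y ⟶ Y') :
    f ⊠₁ 𝟙 Y ≫ 𝟙 X' ⊠₁ g ≅ 𝟙 X ⊠₁ g ≫ f ⊠₁ 𝟙 Y' :=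
  (tensorComp f (𝟙 X') (𝟙 Y) g).symm ≪≫ tensorIso (ρ_ f ≪≫ (λ_ f).symm) (λ_ g ≪≫ (ρ_ g).symm) ≪≫
    tensorComp (𝟙 X) f g (𝟙 Y')

/-- For an adjunction `f ⊣ g`, the adjunction `f1 ⊣ g1`, the image of `f ⊣ g` under the
pseudofunctor `_ ⊠ Y`. -/
def adjTensorRight {X X' : B} {f : X ⟶ X'} {g : X' ⟶ X} (adj : f ⊣ g) (Y : B) :
    f ⊠₁ 𝟙 Y ⊣ g ⊠₁ 𝟙 Y :=
  ((Prod.sectL B Y).toPseudofunctor.comp (TensorBicategory.tensor (B := B))).mapAdjunction adj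

/-- The identity square on `f`. -/
def sqId {X X' : B} (f : X ⟶ X') : f ≫ 𝟙 X' ≅ 𝟙 X ≫ f := ρ_ f ≪≫ (λ_ f).symm

/-- Pasting of two invertible squares along a common edge `f'`. -/
def sqComp {X X' Y Y' Z Z' : B} {f : X ⟶ X'} {f' : Y ⟶ Y'} {f'' : Z ⟶ Z'}
    {t : X ⟶ Y} {t' : X' ⟶ Y'} {s : Y ⟶ Z} {s' : Y' ⟶ Z'}
    (φ : f ≫ t' ≅ t ≫ f') (ψ : f' ≫ s' ≅ s ≫ f'') : f ≫ t' ≫ s' ≅ (t ≫ s) ≫ f'' :=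
  (α_ f t' s').symm ≪≫ whiskerRightIso φ s' ≪≫ α_ t f' s' ≪≫ whiskerLeftIso t ψ ≪≫
    (α_ t s f'').symm

/-- Pasting of two invertible squares along a common edge `t'`. -/
def sqComp' {X X' X'' Y Y' Y'' : B} {f : X ⟶ X'} {g : X' ⟶ X''} {f' : Y ⟶ Y'} {g' : Y' ⟶ Y''}
    {t : X ⟶ Y} {t' : X' ⟶ Y'} {t'' : X'' ⟶ Y''}
    (φ : f ≫ t' ≅ t ≫ f') (ψ : g ≫ t'' ≅ t' ≫ g') : (f ≫ g) ≫ t'' ≅ t ≫ f' ≫ g' :=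
  α_ f g t'' ≪≫ whiskerLeftIso f ψ ≪≫ (α_ f t' g').symm ≪≫ whiskerRightIso φ g' ≪≫ α_ t f' g'

/-- Tensor product of two invertible squares. -/
def sqTensor {X X' Y Y' Z Z' W W' : B} {f : X ⟶ X'} {f' : Y ⟶ Y'} {t : X ⟶ Y} {t' : X' ⟶ Y'}
    {g : Z ⟶ Z'} {g' : W ⟶ W'} {s : Z ⟶ W} {s' : Z' ⟶ W'}
    (φ : f ≫ t' ≅ t ≫ f') (ψ : g ≫ s' ≅ s ≫ g') :
    f ⊠₁ g ≫ t' ⊠₁ s' ≅ t ⊠₁ s ≫ f' ⊠₁ g' :=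
  (tensorComp f t' g s').symm ≪≫ tensorIso φ ψ ≪≫ tensorComp t f' s g'

end Tensor

/-- The data of a monoidal bicategory: a tensor product and a unit, the components of the adjoint
equivalences `a : (XY)Z ⟶ X(YZ)`, `l : IX ⟶ X`, `r : XI ⟶ X` with their pseudonaturality cells,
and the components of the invertible modifications `π` (pentagonator), `μ`, `λ`, `ρ`
(middle, left and right 2-unitors). -/
class MonoidalBicategoryStruct (B : Type u) [Bicategory.{w, v} B] extends TensorBicategory B where
  assoc (X Y Z : B) : (X ⊠ Y) ⊠ Z ≌ X ⊠ (Y ⊠ Z)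
  assocNat {X X' Y Y' Z Z' : B} (f : X ⟶ X') (g : Y ⟶ Y') (h : Z ⟶ Z') :
    (f ⊠₁ g) ⊠₁ h ≫ (assoc X' Y' Z').hom ≅ (assoc X Y Z).hom ≫ f ⊠₁ (g ⊠₁ h)
  left (X : B) : tensorI B ⊠ X ≌ X
  leftNat {X X' : B} (f : X ⟶ X') :
    𝟙 (tensorI B) ⊠₁ f ≫ (left X').hom ≅ (left X).hom ≫ f
  right (X : B) : X ⊠ tensorI B ≌ X
  rightNat {X X' : B} (f : X ⟶ X') :
    f ⊠₁ 𝟙 (tensorI B) ≫ (right X').hom ≅ (right X).hom ≫ f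
  pent (W X Y Z : B) :
    (assoc W X Y).hom ⊠₁ 𝟙 Z ≫ (assoc W (X ⊠ Y) Z).hom ≫ 𝟙 W ⊠₁ (assoc X Y Z).hom ≅
      (assoc (W ⊠ X) Y Z).hom ≫ (assoc W X (Y ⊠ Z)).hom
  midUnit (X Y : B) :
    (right X).hom ⊠₁ 𝟙 Y ≅ (assoc X (tensorI B) Y).hom ≫ 𝟙 X ⊠₁ (left Y).hom
  leftUnit (X Y : B) :
    (left X).hom ⊠₁ 𝟙 Y ≅ (assoc (tensorI B) X Y).hom ≫ (left (X ⊠ Y)).hom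
  rightUnit (X Y : B) :
    (right (X ⊠ Y)).hom ≅ (assoc X Y (tensorI B)).hom ≫ 𝟙 X ⊠₁ (right Y).hom

section Struct

variable {B : Type u} [Bicategory.{w, v} B] [MonoidalBicategoryStruct B]

/-- The 1-cell `a : (XY)Z ⟶ X(YZ)`. -/
abbrev as (X Y Z : B) : (X ⊠ Y) ⊠ Z ⟶ X ⊠ (Y ⊠ Z) := (MonoidalBicategoryStruct.assoc X Y Z).hom

/-- The 1-cell `l : IX ⟶ X`. -/
abbrev lu (X : B) : tensorI B ⊠ X ⟶ X := (MonoidalBicategoryStruct.left X).hom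

/-- The 1-cell `r : XI ⟶ X`. -/
abbrev ru (X : B) : X ⊠ tensorI B ⟶ X := (MonoidalBicategoryStruct.right X).hom

open MonoidalBicategoryStruct

/-- Naturality of `a` in the first variable. -/
def assocNat₁ {X X' : B} (f : X ⟶ X') (Y Z : B) :
    (f ⊠₁ 𝟙 Y) ⊠₁ 𝟙 Z ≫ as X' Y Z ≅ as X Y Z ≫ f ⊠₁ 𝟙 (Y ⊠ Z) :=
  assocNat f (𝟙 Y) (𝟙 Z) ≪≫ whiskerLeftIso _ (tensorIso (Iso.refl f) (tensorId Y Z))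

/-- Naturality of `a` in the second variable. -/
def assocNat₂ (X : B) {Y Y' : B} (g : Y ⟶ Y') (Z : B) :
    (𝟙 X ⊠₁ g) ⊠₁ 𝟙 Z ≫ as X Y' Z ≅ as X Y Z ≫ 𝟙 X ⊠₁ (g ⊠₁ 𝟙 Z) :=
  assocNat (𝟙 X) g (𝟙 Z)

/-- Naturality of `a` in the third variable. -/
def assocNat₃ (X Y : B) {Z Z' : B} (h : Z ⟶ Z') :
    𝟙 (X ⊠ Y) ⊠₁ h ≫ as X Y Z' ≅ as X Y Z ≫ 𝟙 X ⊠₁ (𝟙 Y ⊠₁ h) :=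
  whiskerRightIso (tensorIso (tensorId X Y).symm (Iso.refl h)) _ ≪≫ assocNat (𝟙 X) (𝟙 Y) h

/-- The pentagonator `π` tensored on the right with an object. -/
def pentRight (W X Y Z V : B) :
    (as W X Y ⊠₁ 𝟙 Z) ⊠₁ 𝟙 V ≫ as W (X ⊠ Y) Z ⊠₁ 𝟙 V ≫ (𝟙 W ⊠₁ as X Y Z) ⊠₁ 𝟙 V ≅
      as (W ⊠ X) Y Z ⊠₁ 𝟙 V ≫ as W X (Y ⊠ Z) ⊠₁ 𝟙 V :=
  whiskerLeftIso _ (rcomp _ _ V).symm ≪≫ (rcomp _ _ V).symm ≪≫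
    tensorIso (pent W X Y Z) (Iso.refl (𝟙 V)) ≪≫ rcomp _ _ V

/-- The pentagonator `π` tensored on the left with an object. -/
def pentLeft (V W X Y Z : B) :
    𝟙 V ⊠₁ (as W X Y ⊠₁ 𝟙 Z) ≫ 𝟙 V ⊠₁ as W (X ⊠ Y) Z ≫ 𝟙 V ⊠₁ (𝟙 W ⊠₁ as X Y Z) ≅
      𝟙 V ⊠₁ as (W ⊠ X) Y Z ≫ 𝟙 V ⊠₁ as W X (Y ⊠ Z) :=
  whiskerLeftIso _ (lcomp V _ _).symm ≪≫ (lcomp V _ _).symm ≪≫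
    tensorIso (Iso.refl (𝟙 V)) (pent W X Y Z) ≪≫ lcomp V _ _

/-- First side of the associahedron axiom. -/
def associahedronLeft (V W X Y Z : B) :
    ((as V W X ⊠₁ 𝟙 Y) ⊠₁ 𝟙 Z ≫ as V (W ⊠ X) Y ⊠₁ 𝟙 Z ≫ (𝟙 V ⊠₁ as W X Y) ⊠₁ 𝟙 Z) ≫
      as V (W ⊠ (X ⊠ Y)) Z ≫ 𝟙 V ⊠₁ as W (X ⊠ Y) Z ≫ 𝟙 V ⊠₁ (𝟙 W ⊠₁ as X Y Z) ⟶
    as ((V ⊠ W) ⊠ X) Y Z ≫ as (V ⊠ W) X (Y ⊠ Z) ≫ as V W (X ⊠ (Y ⊠ Z)) :=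
  (pentRight V W X Y Z).hom ▷
      (as V (W ⊠ (X ⊠ Y)) Z ≫ 𝟙 V ⊠₁ as W (X ⊠ Y) Z ≫ 𝟙 V ⊠₁ (𝟙 W ⊠₁ as X Y Z)) ⊗≫
    as (V ⊠ W) X Y ⊠₁ 𝟙 Z ◁ (pent V W (X ⊠ Y) Z).hom ▷ (𝟙 V ⊠₁ (𝟙 W ⊠₁ as X Y Z)) ⊗≫
    (as (V ⊠ W) X Y ⊠₁ 𝟙 Z ≫ as (V ⊠ W) (X ⊠ Y) Z) ◁ (assocNat₃ V W (as X Y Z)).inv ⊗≫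
    (pent (V ⊠ W) X Y Z).hom ▷ as V W (X ⊠ (Y ⊠ Z)) ⊗≫
    𝟙 (as ((V ⊠ W) ⊠ X) Y Z ≫ as (V ⊠ W) X (Y ⊠ Z) ≫ as V W (X ⊠ (Y ⊠ Z)))

/-- Second side of the associahedron axiom. -/
def associahedronRight (V W X Y Z : B) :
    ((as V W X ⊠₁ 𝟙 Y) ⊠₁ 𝟙 Z ≫ as V (W ⊠ X) Y ⊠₁ 𝟙 Z ≫ (𝟙 V ⊠₁ as W X Y) ⊠₁ 𝟙 Z) ≫
      as V (W ⊠ (X ⊠ Y)) Z ≫ 𝟙 V ⊠₁ as W (X ⊠ Y) Z ≫ 𝟙 V ⊠₁ (𝟙 W ⊠₁ as X Y Z) ⟶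
    as ((V ⊠ W) ⊠ X) Y Z ≫ as (V ⊠ W) X (Y ⊠ Z) ≫ as V W (X ⊠ (Y ⊠ Z)) :=
  𝟙 _ ⊗≫
    ((as V W X ⊠₁ 𝟙 Y) ⊠₁ 𝟙 Z ≫ as V (W ⊠ X) Y ⊠₁ 𝟙 Z) ◁ (assocNat₂ V (as W X Y) Z).hom ▷
      (𝟙 V ⊠₁ as W (X ⊠ Y) Z ≫ 𝟙 V ⊠₁ (𝟙 W ⊠₁ as X Y Z)) ⊗≫
    ((as V W X ⊠₁ 𝟙 Y) ⊠₁ 𝟙 Z ≫ as V (W ⊠ X) Y ⊠₁ 𝟙 Z ≫ as V ((W ⊠ X) ⊠ Y) Z) ◁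
      (pentLeft V W X Y Z).hom ⊗≫
    (as V W X ⊠₁ 𝟙 Y) ⊠₁ 𝟙 Z ◁ (pent V (W ⊠ X) Y Z).hom ▷ (𝟙 V ⊠₁ as W X (Y ⊠ Z)) ⊗≫
    (assocNat₁ (as V W X) Y Z).hom ▷
      (as V (W ⊠ X) (Y ⊠ Z) ≫ 𝟙 V ⊠₁ as W X (Y ⊠ Z)) ⊗≫
    as ((V ⊠ W) ⊠ X) Y Z ◁ (pent V W X (Y ⊠ Z)).hom

/-- First side of the unit axiom with the unit in the second of four places. -/
def unitAxiomTwoLeft (X Y Z : B) :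
    (as X (tensorI B) Y ⊠₁ 𝟙 Z ≫ as X (tensorI B ⊠ Y) Z ≫ 𝟙 X ⊠₁ as (tensorI B) Y Z) ≫
      𝟙 X ⊠₁ lu (Y ⊠ Z) ⟶ (ru X ⊠₁ 𝟙 Y) ⊠₁ 𝟙 Z ≫ as X Y Z :=
  𝟙 _ ⊗≫
    (as X (tensorI B) Y ⊠₁ 𝟙 Z ≫ as X (tensorI B ⊠ Y) Z) ◁
      ((lcomp X (as (tensorI B) Y Z) (lu (Y ⊠ Z))).inv ≫ 𝟙 (𝟙 X) ⊠₂ (leftUnit Y Z).inv) ⊗≫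
    as X (tensorI B) Y ⊠₁ 𝟙 Z ◁ (assocNat₂ X (lu Y) Z).inv ⊗≫
    ((rcomp (as X (tensorI B) Y) (𝟙 X ⊠₁ lu Y) Z).inv ≫ (midUnit X Y).inv ⊠₂ 𝟙 (𝟙 Z)) ▷ as X Y Z

/-- Second side of the unit axiom with the unit in the second of four places. -/
def unitAxiomTwoRight (X Y Z : B) :
    (as X (tensorI B) Y ⊠₁ 𝟙 Z ≫ as X (tensorI B ⊠ Y) Z ≫ 𝟙 X ⊠₁ as (tensorI B) Y Z) ≫
      𝟙 X ⊠₁ lu (Y ⊠ Z) ⟶ (ru X ⊠₁ 𝟙 Y) ⊠₁ 𝟙 Z ≫ as X Y Z :=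
  (pent X (tensorI B) Y Z).hom ▷ (𝟙 X ⊠₁ lu (Y ⊠ Z)) ⊗≫
    as (X ⊠ tensorI B) Y Z ◁ (midUnit X (Y ⊠ Z)).inv ≫
    (assocNat₁ (ru X) Y Z).inv

/-- First side of the unit axiom with the unit in the third of four places. -/
def unitAxiomThreeLeft (X Y Z : B) :
    (as X Y (tensorI B) ⊠₁ 𝟙 Z ≫ as X (Y ⊠ tensorI B) Z ≫ 𝟙 X ⊠₁ as Y (tensorI B) Z) ≫
      𝟙 X ⊠₁ (𝟙 Y ⊠₁ lu Z) ⟶ ru (X ⊠ Y) ⊠₁ 𝟙 Z ≫ as X Y Z :=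
  𝟙 _ ⊗≫
    (as X Y (tensorI B) ⊠₁ 𝟙 Z ≫ as X (Y ⊠ tensorI B) Z) ◁
      ((lcomp X (as Y (tensorI B) Z) (𝟙 Y ⊠₁ lu Z)).inv ≫ 𝟙 (𝟙 X) ⊠₂ (midUnit Y Z).inv) ⊗≫
    as X Y (tensorI B) ⊠₁ 𝟙 Z ◁ (assocNat₂ X (ru Y) Z).inv ⊗≫
    ((rcomp (as X Y (tensorI B)) (𝟙 X ⊠₁ ru Y) Z).inv ≫ (rightUnit X Y).inv ⊠₂ 𝟙 (𝟙 Z)) ▷ as X Y Z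

/-- Second side of the unit axiom with the unit in the third of four places. -/
def unitAxiomThreeRight (X Y Z : B) :
    (as X Y (tensorI B) ⊠₁ 𝟙 Z ≫ as X (Y ⊠ tensorI B) Z ≫ 𝟙 X ⊠₁ as Y (tensorI B) Z) ≫
      𝟙 X ⊠₁ (𝟙 Y ⊠₁ lu Z) ⟶ ru (X ⊠ Y) ⊠₁ 𝟙 Z ≫ as X Y Z :=
  (pent X Y (tensorI B) Z).hom ▷ (𝟙 X ⊠₁ (𝟙 Y ⊠₁ lu Z)) ⊗≫
    as (X ⊠ Y) (tensorI B) Z ◁ (assocNat₃ X Y (lu Z)).inv ⊗≫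
    (midUnit (X ⊠ Y) Z).inv ▷ as X Y Z

end Struct

open MonoidalBicategoryStruct in
/-- A monoidal bicategory: a tricategory with one object. The axioms say that `a`, `l`, `r` are
pseudonatural, that `π`, `μ`, `λ`, `ρ` are modifications, and the three coherence axioms. -/
class MonoidalBicategory (B : Type u) [Bicategory.{w, v} B] extends
    MonoidalBicategoryStruct B where
  assocNat_natural {X X' Y Y' Z Z' : B} {f f' : X ⟶ X'} {g g' : Y ⟶ Y'} {h h' : Z ⟶ Z'}
    (η : f ⟶ f') (θ : g ⟶ g') (ζ : h ⟶ h') :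
    ((η ⊠₂ θ) ⊠₂ ζ) ▷ as X' Y' Z' ≫ (assocNat f' g' h').hom =
      (assocNat f g h).hom ≫ as X Y Z ◁ (η ⊠₂ (θ ⊠₂ ζ))
  assocNat_id (X Y Z : B) :
    assocNat (𝟙 X) (𝟙 Y) (𝟙 Z) =
      whiskerRightIso (tensorIso (tensorId X Y) (Iso.refl (𝟙 Z)) ≪≫ tensorId (X ⊠ Y) Z) _ ≪≫
        (sqId (as X Y Z)).symm ≪≫
        whiskerLeftIso _ (tensorIso (Iso.refl (𝟙 X)) (tensorId Y Z) ≪≫ tensorId X (Y ⊠ Z)).symm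
  assocNat_comp {X X' X'' Y Y' Y'' Z Z' Z'' : B} (f : X ⟶ X') (f' : X' ⟶ X'')
    (g : Y ⟶ Y') (g' : Y' ⟶ Y'') (h : Z ⟶ Z') (h' : Z' ⟶ Z'') :
    assocNat (f ≫ f') (g ≫ g') (h ≫ h') =
      whiskerRightIso (tensorIso (tensorComp f f' g g') (Iso.refl (h ≫ h')) ≪≫
        tensorComp (f ⊠₁ g) (f' ⊠₁ g') h h') _ ≪≫
      sqComp' (assocNat f g h) (assocNat f' g' h') ≪≫
      whiskerLeftIso _ (tensorIso (Iso.refl (f ≫ f')) (tensorComp g g' h h') ≪≫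
        tensorComp f f' (g ⊠₁ h) (g' ⊠₁ h')).symm
  leftNat_natural {X X' : B} {f f' : X ⟶ X'} (η : f ⟶ f') :
    (𝟙 (𝟙 (tensorI B)) ⊠₂ η) ▷ lu X' ≫ (leftNat f').hom = (leftNat f).hom ≫ lu X ◁ η
  leftNat_id (X : B) :
    leftNat (𝟙 X) = whiskerRightIso (tensorId (tensorI B) X) _ ≪≫ (sqId (lu X)).symm
  leftNat_comp {X X' X'' : B} (f : X ⟶ X') (f' : X' ⟶ X'') :
    leftNat (f ≫ f') =
      whiskerRightIso (lcomp (tensorI B) f f') _ ≪≫ sqComp' (leftNat f) (leftNat f')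
  rightNat_natural {X X' : B} {f f' : X ⟶ X'} (η : f ⟶ f') :
    (η ⊠₂ 𝟙 (𝟙 (tensorI B))) ▷ ru X' ≫ (rightNat f').hom = (rightNat f).hom ≫ ru X ◁ η
  rightNat_id (X : B) :
    rightNat (𝟙 X) = whiskerRightIso (tensorId X (tensorI B)) _ ≪≫ (sqId (ru X)).symm
  rightNat_comp {X X' X'' : B} (f : X ⟶ X') (f' : X' ⟶ X'') :
    rightNat (f ≫ f') =
      whiskerRightIso (rcomp f f' (tensorI B)) _ ≪≫ sqComp' (rightNat f) (rightNat f')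
  pent_natural {W W' X X' Y Y' Z Z' : B} (e : W ⟶ W') (f : X ⟶ X') (g : Y ⟶ Y') (h : Z ⟶ Z') :
    ((e ⊠₁ f) ⊠₁ g) ⊠₁ h ◁ (pent W' X' Y' Z').hom ≫
        (sqComp (assocNat (e ⊠₁ f) g h) (assocNat e f (g ⊠₁ h))).hom =
      (sqComp (sqTensor (assocNat e f g) (sqId h)) (sqComp (assocNat e (f ⊠₁ g) h)
        (sqTensor (sqId e) (assocNat f g h)))).hom ≫
        (pent W X Y Z).hom ▷ (e ⊠₁ (f ⊠₁ (g ⊠₁ h)))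
  midUnit_natural {X X' Y Y' : B} (f : X ⟶ X') (g : Y ⟶ Y') :
    (f ⊠₁ 𝟙 (tensorI B)) ⊠₁ g ◁ (midUnit X' Y').hom ≫
        (sqComp (assocNat f (𝟙 (tensorI B)) g) (sqTensor (sqId f) (leftNat g))).hom =
      (sqTensor (rightNat f) (sqId g)).hom ≫ (midUnit X Y).hom ▷ (f ⊠₁ g)
  leftUnit_natural {X X' Y Y' : B} (f : X ⟶ X') (g : Y ⟶ Y') :
    (𝟙 (tensorI B) ⊠₁ f) ⊠₁ g ◁ (leftUnit X' Y').hom ≫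
        (sqComp (assocNat (𝟙 (tensorI B)) f g) (leftNat (f ⊠₁ g))).hom =
      (sqTensor (leftNat f) (sqId g)).hom ≫ (leftUnit X Y).hom ▷ (f ⊠₁ g)
  rightUnit_natural {X X' Y Y' : B} (f : X ⟶ X') (g : Y ⟶ Y') :
    (f ⊠₁ g) ⊠₁ 𝟙 (tensorI B) ◁ (rightUnit X' Y').hom ≫
        (sqComp (assocNat f g (𝟙 (tensorI B))) (sqTensor (sqId f) (rightNat g))).hom =
      (rightNat (f ⊠₁ g)).hom ≫ (rightUnit X Y).hom ▷ (f ⊠₁ g)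
  associahedron (V W X Y Z : B) : associahedronLeft V W X Y Z = associahedronRight V W X Y Z
  unitAxiomTwo (X Y Z : B) : unitAxiomTwoLeft X Y Z = unitAxiomTwoRight X Y Z
  unitAxiomThree (X Y Z : B) : unitAxiomThreeLeft X Y Z = unitAxiomThreeRight X Y Z

section UnitIso

variable {B : Type u} [Bicategory.{w, v} B]

/-- Postcomposition with an equivalence reflects isomorphisms of 1-cells. -/
def cancelRight {X Y Z : B} (e : Y ≌ Z) {f g : X ⟶ Y} (φ : f ≫ e.hom ≅ g ≫ e.hom) : f ≅ g :=
  (ρ_ f).symm ≪≫ whiskerLeftIso f e.unit ≪≫ (α_ f e.hom e.inv).symm ≪≫ whiskerRightIso φ e.inv ≪≫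
    α_ g e.hom e.inv ≪≫ whiskerLeftIso g e.unit.symm ≪≫ ρ_ g

/-- Precomposition with an equivalence reflects isomorphisms of 1-cells. -/
def cancelLeft {X Y Z : B} (e : X ≌ Y) {f g : Y ⟶ Z} (φ : e.hom ≫ f ≅ e.hom ≫ g) : f ≅ g :=
  (λ_ f).symm ≪≫ whiskerRightIso e.counit.symm f ≪≫ α_ e.inv e.hom f ≪≫ whiskerLeftIso e.inv φ ≪≫
    (α_ e.inv e.hom g).symm ≪≫ whiskerRightIso e.counit g ≪≫ λ_ g

open MonoidalBicategoryStruct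

variable [MonoidalBicategoryStruct B]

variable (B) in
/-- The canonical isomorphism `l1 ≅ r1 : (II)I ⟶ II`, determined after postcomposition with `l`. -/
def unitIsoTensor :
    lu (tensorI B) ⊠₁ 𝟙 (tensorI B) ≅ ru (tensorI B) ⊠₁ 𝟙 (tensorI B) :=
  cancelRight (left (tensorI B))
    (whiskerRightIso (leftUnit (tensorI B) (tensorI B)) _ ≪≫ α_ _ _ _ ≪≫
      whiskerLeftIso _ (leftNat (lu (tensorI B))).symm ≪≫ (α_ _ _ _).symm ≪≫
      whiskerRightIso (midUnit (tensorI B) (tensorI B)).symm _)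

variable (B) in
/-- The canonical isomorphism `l ≅ r : II ⟶ I`, composed of constraint cells. -/
def unitIso : lu (tensorI B) ≅ ru (tensorI B) :=
  cancelLeft (right (tensorI B ⊠ tensorI B))
    ((rightNat (lu (tensorI B))).symm ≪≫ whiskerRightIso (unitIsoTensor B) _ ≪≫
      rightNat (ru (tensorI B)))

end UnitIso

/-! ### Right skew monoidales and oplax actions -/

/-- The data of a right skew monoidale: an object, a product and a unit 1-cell, and the associator,
left unitor and right unitor 2-cells (not necessarily invertible). -/
structure RightSkewMonoidaleData (B : Type u) [Bicategory.{w, v} B]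
    [MonoidalBicategoryStruct B] where
  obj : B
  mul : obj ⊠ obj ⟶ obj
  one : tensorI B ⟶ obj
  assocCell : as obj obj obj ≫ 𝟙 obj ⊠₁ mul ≫ mul ⟶ mul ⊠₁ 𝟙 obj ≫ mul
  leftCell : lu obj ⟶ one ⊠₁ 𝟙 obj ≫ mul
  rightCell : 𝟙 obj ⊠₁ one ≫ mul ⟶ ru obj

/-- The data of an oplax right `M`-action on `A`. -/
structure OplaxActionData {B : Type u} [Bicategory.{w, v} B] [MonoidalBicategoryStruct B]
    (M : RightSkewMonoidaleData B) (A : B) where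
  act : A ⊠ M.obj ⟶ A
  actAssoc : as A M.obj M.obj ≫ 𝟙 A ⊠₁ M.mul ≫ act ⟶ act ⊠₁ 𝟙 M.obj ≫ act
  actUnit : 𝟙 A ⊠₁ M.one ≫ act ⟶ ru A

section Axioms

variable {B : Type u} [Bicategory.{w, v} B] [MonoidalBicategoryStruct B]

open MonoidalBicategoryStruct

namespace OplaxActionData

variable {M : RightSkewMonoidaleData B} {A : B} (a : OplaxActionData M A)

/-- The composite `x(p(qs)) ⟶ (xp)(qs) ⟶ ((xp)q)s`. -/
def pentagonLeft :
    (as (A ⊠ M.obj) M.obj M.obj ≫ as A M.obj (M.obj ⊠ M.obj)) ≫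
      𝟙 A ⊠₁ (𝟙 M.obj ⊠₁ M.mul) ≫ 𝟙 A ⊠₁ M.mul ≫ a.act ⟶
    (a.act ⊠₁ 𝟙 M.obj) ⊠₁ 𝟙 M.obj ≫ a.act ⊠₁ 𝟙 M.obj ≫ a.act :=
  𝟙 _ ⊗≫
    as (A ⊠ M.obj) M.obj M.obj ◁ (assocNat₃ A M.obj M.mul).inv ▷ (𝟙 A ⊠₁ M.mul ≫ a.act) ⊗≫
    (as (A ⊠ M.obj) M.obj M.obj ≫ 𝟙 (A ⊠ M.obj) ⊠₁ M.mul) ◁ a.actAssoc ⊗≫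
    as (A ⊠ M.obj) M.obj M.obj ◁ (interchange a.act M.mul).inv ▷ a.act ⊗≫
    (assocNat₁ a.act M.obj M.obj).inv ▷ (𝟙 A ⊠₁ M.mul ≫ a.act) ⊗≫
    (a.act ⊠₁ 𝟙 M.obj) ⊠₁ 𝟙 M.obj ◁ a.actAssoc

/-- The composite `x(p(qs)) ⟶ x((pq)s) ⟶ (x(pq))s ⟶ ((xp)q)s`. -/
def pentagonRight :
    (as (A ⊠ M.obj) M.obj M.obj ≫ as A M.obj (M.obj ⊠ M.obj)) ≫
      𝟙 A ⊠₁ (𝟙 M.obj ⊠₁ M.mul) ≫ 𝟙 A ⊠₁ M.mul ≫ a.act ⟶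
    (a.act ⊠₁ 𝟙 M.obj) ⊠₁ 𝟙 M.obj ≫ a.act ⊠₁ 𝟙 M.obj ≫ a.act :=
  (pent A M.obj M.obj M.obj).inv ▷
      (𝟙 A ⊠₁ (𝟙 M.obj ⊠₁ M.mul) ≫ 𝟙 A ⊠₁ M.mul ≫ a.act) ⊗≫
    (as A M.obj M.obj ⊠₁ 𝟙 M.obj ≫ as A (M.obj ⊠ M.obj) M.obj) ◁
      (𝟙 A ⊠₁ as M.obj M.obj M.obj ◁ (lcomp A (𝟙 M.obj ⊠₁ M.mul) M.mul).inv ≫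
        (lcomp A (as M.obj M.obj M.obj) (𝟙 M.obj ⊠₁ M.mul ≫ M.mul)).inv ≫
        𝟙 (𝟙 A) ⊠₂ M.assocCell ≫
        (lcomp A (M.mul ⊠₁ 𝟙 M.obj) M.mul).hom) ▷ a.act ⊗≫
    as A M.obj M.obj ⊠₁ 𝟙 M.obj ◁ (assocNat₂ A M.mul M.obj).inv ▷ (𝟙 A ⊠₁ M.mul ≫ a.act) ⊗≫
    (as A M.obj M.obj ⊠₁ 𝟙 M.obj ≫ (𝟙 A ⊠₁ M.mul) ⊠₁ 𝟙 M.obj) ◁ a.actAssoc ⊗≫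
    (as A M.obj M.obj ⊠₁ 𝟙 M.obj ◁ (rcomp (𝟙 A ⊠₁ M.mul) a.act M.obj).inv ≫
      (rcomp (as A M.obj M.obj) (𝟙 A ⊠₁ M.mul ≫ a.act) M.obj).inv ≫
      a.actAssoc ⊠₂ 𝟙 (𝟙 M.obj) ≫
      (rcomp (a.act ⊠₁ 𝟙 M.obj) a.act M.obj).hom) ▷ a.act ⊗≫
    𝟙 _

/-- The composite `x(pu) ⟶ xp` given by the right unitor of `M`. -/
def rightUnitLeft :
    as A M.obj (tensorI B) ≫ 𝟙 A ⊠₁ (𝟙 M.obj ⊠₁ M.one) ≫ 𝟙 A ⊠₁ M.mul ≫ a.act ⟶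
      ru (A ⊠ M.obj) ≫ a.act :=
  𝟙 _ ⊗≫
    as A M.obj (tensorI B) ◁
      ((lcomp A (𝟙 M.obj ⊠₁ M.one) M.mul).inv ≫ 𝟙 (𝟙 A) ⊠₂ M.rightCell) ▷ a.act ⊗≫
    (rightUnit A M.obj).inv ▷ a.act

/-- The composite `x(pu) ⟶ (xp)u ⟶ xp`. -/
def rightUnitRight :
    as A M.obj (tensorI B) ≫ 𝟙 A ⊠₁ (𝟙 M.obj ⊠₁ M.one) ≫ 𝟙 A ⊠₁ M.mul ≫ a.act ⟶
      ru (A ⊠ M.obj) ≫ a.act :=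
  𝟙 _ ⊗≫
    (assocNat₃ A M.obj M.one).inv ▷ (𝟙 A ⊠₁ M.mul ≫ a.act) ⊗≫
    𝟙 (A ⊠ M.obj) ⊠₁ M.one ◁ a.actAssoc ⊗≫
    (interchange a.act M.one).inv ▷ a.act ⊗≫
    a.act ⊠₁ 𝟙 (tensorI B) ◁ a.actUnit ≫
    (rightNat a.act).hom

/-- The composite `xp ⟶ x(up) ⟶ (xu)p ⟶ xp`. -/
def triangleLeft :
    as A (tensorI B) M.obj ≫ 𝟙 A ⊠₁ lu M.obj ≫ a.act ⟶ ru A ⊠₁ 𝟙 M.obj ≫ a.act :=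
  as A (tensorI B) M.obj ◁
      ((𝟙 (𝟙 A) ⊠₂ M.leftCell) ≫ (lcomp A (M.one ⊠₁ 𝟙 M.obj) M.mul).hom) ▷ a.act ⊗≫
    (assocNat₂ A M.one M.obj).inv ▷ (𝟙 A ⊠₁ M.mul ≫ a.act) ⊗≫
    (𝟙 A ⊠₁ M.one) ⊠₁ 𝟙 M.obj ◁ a.actAssoc ⊗≫
    ((rcomp (𝟙 A ⊠₁ M.one) a.act M.obj).inv ≫ a.actUnit ⊠₂ 𝟙 (𝟙 M.obj)) ▷ a.act

/-- The constraint isomorphism that stands for the identity of `xp`. -/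
def triangleRight :
    as A (tensorI B) M.obj ≫ 𝟙 A ⊠₁ lu M.obj ≫ a.act ⟶ ru A ⊠₁ 𝟙 M.obj ≫ a.act :=
  𝟙 _ ⊗≫ (midUnit A M.obj).inv ▷ a.act

/-- The three axioms of an oplax right action. -/
structure IsOplaxAction : Prop where
  pentagon : a.pentagonLeft = a.pentagonRight
  rightUnit : a.rightUnitLeft = a.rightUnitRight
  triangle : a.triangleLeft = a.triangleRight

end OplaxActionData

namespace RightSkewMonoidaleData

variable (M : RightSkewMonoidaleData B)

/-- `M` acting on itself. -/
def regular : OplaxActionData M M.obj where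
  act := M.mul
  actAssoc := M.assocCell
  actUnit := M.rightCell

/-- The composite `pq ⟶ u(pq) ⟶ (up)q`. -/
def leftUnitLeft :
    as (tensorI B) M.obj M.obj ≫ lu (M.obj ⊠ M.obj) ≫ M.mul ⟶
      (M.one ⊠₁ 𝟙 M.obj) ⊠₁ 𝟙 M.obj ≫ M.mul ⊠₁ 𝟙 M.obj ≫ M.mul :=
  as (tensorI B) M.obj M.obj ◁ (leftNat M.mul).inv ⊗≫
    (as (tensorI B) M.obj M.obj ≫ 𝟙 (tensorI B) ⊠₁ M.mul) ◁ M.leftCell ⊗≫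
    as (tensorI B) M.obj M.obj ◁ (interchange M.one M.mul).inv ▷ M.mul ⊗≫
    (assocNat₁ M.one M.obj M.obj).inv ▷ (𝟙 M.obj ⊠₁ M.mul ≫ M.mul) ⊗≫
    (M.one ⊠₁ 𝟙 M.obj) ⊠₁ 𝟙 M.obj ◁ M.assocCell

/-- The composite `pq ⟶ (up)q` given by the left unitor at `p`. -/
def leftUnitRight :
    as (tensorI B) M.obj M.obj ≫ lu (M.obj ⊠ M.obj) ≫ M.mul ⟶
      (M.one ⊠₁ 𝟙 M.obj) ⊠₁ 𝟙 M.obj ≫ M.mul ⊠₁ 𝟙 M.obj ≫ M.mul :=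
  𝟙 _ ⊗≫ (leftUnit M.obj M.obj).inv ▷ M.mul ⊗≫
    (M.leftCell ⊠₂ 𝟙 (𝟙 M.obj) ≫ (rcomp (M.one ⊠₁ 𝟙 M.obj) M.mul M.obj).hom) ▷ M.mul ⊗≫
    𝟙 _

/-- The composite `u ⟶ uu ⟶ u`. -/
def unitLeft : 𝟙 (tensorI B) ⊠₁ M.one ≫ lu M.obj ⟶ M.one ⊠₁ 𝟙 (tensorI B) ≫ ru M.obj :=
  𝟙 (tensorI B) ⊠₁ M.one ◁ M.leftCell ⊗≫
    (interchange M.one M.one).inv ▷ M.mul ⊗≫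
    M.one ⊠₁ 𝟙 (tensorI B) ◁ M.rightCell

/-- The constraint isomorphism that stands for the identity of `u`. -/
def unitRight : 𝟙 (tensorI B) ⊠₁ M.one ≫ lu M.obj ⟶ M.one ⊠₁ 𝟙 (tensorI B) ≫ ru M.obj :=
  (leftNat M.one).hom ≫ (unitIso B).hom ▷ M.one ≫ (rightNat M.one).inv

end RightSkewMonoidaleData

end Axioms

/-- A right skew monoidale. The pentagon, the compatibility of the associator with the right
unitor, and the triangle are the axioms of an oplax action for `M` acting on itself. -/
structure RightSkewMonoidale (B : Type u) [Bicategory.{w, v} B] [MonoidalBicategoryStruct B] extends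
    RightSkewMonoidaleData B where
  pentagon : toRightSkewMonoidaleData.regular.pentagonLeft =
    toRightSkewMonoidaleData.regular.pentagonRight
  triangle : toRightSkewMonoidaleData.regular.triangleLeft =
    toRightSkewMonoidaleData.regular.triangleRight
  leftUnit : toRightSkewMonoidaleData.leftUnitLeft = toRightSkewMonoidaleData.leftUnitRight
  rightUnit : toRightSkewMonoidaleData.regular.rightUnitLeft =
    toRightSkewMonoidaleData.regular.rightUnitRight
  unit : toRightSkewMonoidaleData.unitLeft = toRightSkewMonoidaleData.unitRight

section Induced

variable {B : Type u} [Bicategory.{w, v} B] [MonoidalBicategoryStruct B]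

open MonoidalBicategoryStruct

/-- The right skew structure on `R` induced by an adjunction `i ⊣ i*` between `I` and `R`: the
product is `i*1 : RR ⟶ IR ≃ R`, the unit is `i`, the associator is the constraint isomorphism, and
the unitors are given by the unit `η` and the counit `ε` of the adjunction. -/
def inducedSkew {R : B} {i : tensorI B ⟶ R} {i' : R ⟶ tensorI B} (adj : i ⊣ i') :
    RightSkewMonoidaleData B where
  obj := R
  mul := i' ⊠₁ 𝟙 R ≫ lu R
  one := i
  assocCell :=
    𝟙 _ ⊗≫ as R R R ◁ (interchange i' (i' ⊠₁ 𝟙 R ≫ lu R)).inv ▷ lu R ⊗≫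
      (assocNat₁ i' R R).inv ▷ (𝟙 (tensorI B) ⊠₁ (i' ⊠₁ 𝟙 R ≫ lu R) ≫ lu R) ⊗≫
      ((i' ⊠₁ 𝟙 R) ⊠₁ 𝟙 R ≫ as (tensorI B) R R) ◁ (leftNat (i' ⊠₁ 𝟙 R ≫ lu R)).hom ⊗≫
      (i' ⊠₁ 𝟙 R) ⊠₁ 𝟙 R ◁ (leftUnit R R).inv ▷ (i' ⊠₁ 𝟙 R ≫ lu R) ⊗≫
      (rcomp (i' ⊠₁ 𝟙 R) (lu R) R).inv ▷ (i' ⊠₁ 𝟙 R ≫ lu R)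
  leftCell :=
    (λ_ (lu R)).inv ≫ (adjTensorRight adj R).unit ▷ lu R ≫ (α_ _ _ _).hom
  rightCell :=
    𝟙 _ ⊗≫ (interchange i' i).inv ▷ lu R ⊗≫
      i' ⊠₁ 𝟙 (tensorI B) ◁ (leftNat i).hom ⊗≫
      i' ⊠₁ 𝟙 (tensorI B) ◁ (unitIso B).hom ▷ i ⊗≫
      (rightNat i').hom ▷ i ⊗≫
      ru R ◁ adj.counit ⊗≫ 𝟙 _

namespace RightSkewMonoidaleData

variable (S : RightSkewMonoidaleData B) {i' : S.obj ⟶ tensorI B} (adj : S.one ⊣ i')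

/-- The mate `κ : i*1 ⟶ m` of the left unitor `λ : 1 ⟶ m(i1)`. -/
def mate : i' ⊠₁ 𝟙 S.obj ≫ lu S.obj ⟶ S.mul :=
  (adjTensorRight adj S.obj).homEquiv₁ S.leftCell

/-- The action of `R` on itself with action 1-cell `m`, unitor `ρ`, and associator `1κ` followed
by `α`. -/
def underlyingAction : OplaxActionData (inducedSkew adj) S.obj where
  act := S.mul
  actAssoc :=
    as S.obj S.obj S.obj ◁ (𝟙 (𝟙 S.obj) ⊠₂ S.mate adj) ▷ S.mul ≫ S.assocCell
  actUnit := S.rightCell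

end RightSkewMonoidaleData

end Induced

end MonBicat

open MonBicat

/-! The mate `κ : i*1 ⟶ m`, together with the identity on `i`, is a morphism of right skew
structures from the one induced by `i ⊣ i*` to `(m, i, α, λ, ρ)`. An oplax action can be restricted
along any such morphism: precompose the associator with `1κ` and keep the unitor. The action in the
theorem is the restriction of `R` acting on itself by `m`, and the three axioms of that regular
action are the pentagon, the `α`-`ρ` axiom and the triangle of the skew monoidale.

Restriction (`IsOplaxAction.restrict`) is a matter of naturality. Every copy of `κ` slides back
through the constraint cells until it reaches either the start of the composite or a structure cell
of the induced skew structure, where compatibility of `κ` with that cell applies. No adjunction is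
involved.

The adjunction and the two remaining axioms enter in showing that `κ` is a morphism. Compatibility
with the left unitors says that transposing `λ` to `κ` and back gives `λ`. For the other two, `κ` is
expanded as `λ` followed by the counit `ε1`, and the counit is moved to the far left past
interchange, associativity and unit cells. What remains under `i*` is, for the right unitors, the
composite `u ⟶ uu ⟶ u`, removed by the unit axiom. For the associators it is the composite of `λ`
and `α`, which the left unit axiom turns into `λ1`; with the displaced counit this reassembles to
`κ1`.

Moving the counit uses only pseudonaturality of the constraints with respect to a 2-cell `g ≫ f ⟶
1`, hence the auxiliary `tensorCounit`, defined for any such 2-cell. -/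

namespace MonBicat

/-! ### Coherence of the tensor pseudofunctor, interchange and tensored counits. -/

section TensorCalculus

variable {B : Type u} [Bicategory.{w, v} B] [TensorBicategory B]

lemma tensorHom₂_comp {X X' Y Y' : B} {f f' f'' : X ⟶ X'} {g g' g'' : Y ⟶ Y'} (η : f ⟶ f')
    (η' : f' ⟶ f'') (θ : g ⟶ g') (θ' : g' ⟶ g'') :
    (η ≫ η') ⊠₂ (θ ≫ θ') = η ⊠₂ θ ≫ η' ⊠₂ θ' :=
  (TensorBicategory.tensor (B := B)).map₂_comp (f := Prod.mkHom f g) (g := Prod.mkHom f' g')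
    (h := Prod.mkHom f'' g'') (Prod.mkHom η θ) (Prod.mkHom η' θ')

lemma tensorHom₂_id {X X' Y Y' : B} (f : X ⟶ X') (g : Y ⟶ Y') :
    𝟙 f ⊠₂ 𝟙 g = 𝟙 (f ⊠₁ g) :=
  (TensorBicategory.tensor (B := B)).map₂_id (Prod.mkHom f g)

lemma tensorIso_hom {X X' Y Y' : B} {f f' : X ⟶ X'} {g g' : Y ⟶ Y'} (e : f ≅ f') (e' : g ≅ g') :
    (tensorIso e e').hom = e.hom ⊠₂ e'.hom := rfl

lemma tensorIso_inv {X X' Y Y' : B} {f f' : X ⟶ X'} {g g' : Y ⟶ Y'} (e : f ≅ f') (e' : g ≅ g') :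
    (tensorIso e e').inv = e.inv ⊠₂ e'.inv := rfl

lemma whiskerLeft_tensorHom₂_whiskerLeft {X X' X'' Y Y' Y'' : B} (f : X ⟶ X') {g g' : X' ⟶ X''}
    (η : g ⟶ g') (h : Y ⟶ Y') {k k' : Y' ⟶ Y''} (θ : k ⟶ k') :
    (f ◁ η) ⊠₂ (h ◁ θ) =
      (tensorComp f g h k).hom ≫ f ⊠₁ h ◁ η ⊠₂ θ ≫ (tensorComp f g' h k').inv :=
  (TensorBicategory.tensor (B := B)).map₂_whisker_left (Prod.mkHom f h)
    (g := Prod.mkHom g k) (h := Prod.mkHom g' k') (Prod.mkHom η θ)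

lemma whiskerRight_tensorHom₂_whiskerRight {X X' X'' Y Y' Y'' : B} {f f' : X ⟶ X'} (η : f ⟶ f')
    (g : X' ⟶ X'') {h h' : Y ⟶ Y'} (θ : h ⟶ h') (k : Y' ⟶ Y'') :
    (η ▷ g) ⊠₂ (θ ▷ k) =
      (tensorComp f g h k).hom ≫ (η ⊠₂ θ) ▷ (g ⊠₁ k) ≫ (tensorComp f' g h' k).inv :=
  (TensorBicategory.tensor (B := B)).map₂_whisker_right (f := Prod.mkHom f h)
    (g := Prod.mkHom f' h') (Prod.mkHom η θ) (Prod.mkHom g k)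

lemma associator_tensorHom₂_associator {X X' X'' X''' Y Y' Y'' Y''' : B} (f : X ⟶ X')
    (g : X' ⟶ X'') (h : X'' ⟶ X''') (f' : Y ⟶ Y') (g' : Y' ⟶ Y'') (h' : Y'' ⟶ Y''') :
    (α_ f g h).hom ⊠₂ (α_ f' g' h').hom =
      (tensorComp (f ≫ g) h (f' ≫ g') h').hom ≫ (tensorComp f g f' g').hom ▷ (h ⊠₁ h') ≫
        (α_ (f ⊠₁ f') (g ⊠₁ g') (h ⊠₁ h')).hom ≫ f ⊠₁ f' ◁ (tensorComp g h g' h').inv ≫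
        (tensorComp f (g ≫ h) f' (g' ≫ h')).inv :=
  (TensorBicategory.tensor (B := B)).map₂_associator (Prod.mkHom f f') (Prod.mkHom g g')
    (Prod.mkHom h h')

lemma leftUnitor_tensorHom₂_leftUnitor {X X' Y Y' : B} (f : X ⟶ X') (g : Y ⟶ Y') :
    (λ_ f).hom ⊠₂ (λ_ g).hom =
      (tensorComp (𝟙 X) f (𝟙 Y) g).hom ≫ (tensorId X Y).hom ▷ (f ⊠₁ g) ≫ (λ_ (f ⊠₁ g)).hom :=
  (TensorBicategory.tensor (B := B)).map₂_left_unitor (Prod.mkHom f g)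

lemma rightUnitor_tensorHom₂_rightUnitor {X X' Y Y' : B} (f : X ⟶ X') (g : Y ⟶ Y') :
    (ρ_ f).hom ⊠₂ (ρ_ g).hom =
      (tensorComp f (𝟙 X') g (𝟙 Y')).hom ≫ f ⊠₁ g ◁ (tensorId X' Y').hom ≫ (ρ_ (f ⊠₁ g)).hom :=
  (TensorBicategory.tensor (B := B)).map₂_right_unitor (Prod.mkHom f g)

lemma tensorComp_hom_whiskerLeft {X X' X'' Y Y' Y'' : B} (f : X ⟶ X') {g g' : X' ⟶ X''}
    (η : g ⟶ g') (h : Y ⟶ Y') {k k' : Y' ⟶ Y''} (θ : k ⟶ k') :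
    (tensorComp f g h k).hom ≫ f ⊠₁ h ◁ η ⊠₂ θ =
      (f ◁ η) ⊠₂ (h ◁ θ) ≫ (tensorComp f g' h k').hom := by
  simp [whiskerLeft_tensorHom₂_whiskerLeft]

lemma tensorComp_hom_whiskerRight {X X' X'' Y Y' Y'' : B} {f f' : X ⟶ X'} (η : f ⟶ f')
    (g : X' ⟶ X'') {h h' : Y ⟶ Y'} (θ : h ⟶ h') (k : Y' ⟶ Y'') :
    (tensorComp f g h k).hom ≫ (η ⊠₂ θ) ▷ (g ⊠₁ k) =
      (η ▷ g) ⊠₂ (θ ▷ k) ≫ (tensorComp f' g h' k).hom := by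
  simp [whiskerRight_tensorHom₂_whiskerRight]

/-- Oriented, like its neighbours, to push `tensorComp` to the right. The 2-cells left of it then
merge into one tensor product, which can be compared factor by factor. -/
lemma tensorComp_hom_associator_hom {X X' X'' X''' Y Y' Y'' Y''' : B} (f : X ⟶ X')
    (g : X' ⟶ X'') (h : X'' ⟶ X''') (f' : Y ⟶ Y') (g' : Y' ⟶ Y'') (h' : Y'' ⟶ Y''') :
    (tensorComp (f ≫ g) h (f' ≫ g') h').hom ≫ (tensorComp f g f' g').hom ▷ (h ⊠₁ h') ≫
        (α_ (f ⊠₁ f') (g ⊠₁ g') (h ⊠₁ h')).hom =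
      (α_ f g h).hom ⊠₂ (α_ f' g' h').hom ≫ (tensorComp f (g ≫ h) f' (g' ≫ h')).hom ≫
        f ⊠₁ f' ◁ (tensorComp g h g' h').hom := by
  simp [associator_tensorHom₂_associator]

lemma tensorHom₂_hom_inv {X X' Y Y' : B} {f f' : X ⟶ X'} {g g' : Y ⟶ Y'} (e : f ≅ f')
    (e' : g ≅ g') : e.hom ⊠₂ e'.hom ≫ e.inv ⊠₂ e'.inv = 𝟙 (f ⊠₁ g) :=
  (tensorIso e e').hom_inv_id

lemma tensorComp_hom_associator_inv {X X' X'' X''' Y Y' Y'' Y''' : B} (f : X ⟶ X')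
    (g : X' ⟶ X'') (h : X'' ⟶ X''') (f' : Y ⟶ Y') (g' : Y' ⟶ Y'') (h' : Y'' ⟶ Y''') :
    (tensorComp f (g ≫ h) f' (g' ≫ h')).hom ≫ f ⊠₁ f' ◁ (tensorComp g h g' h').hom ≫
        (α_ (f ⊠₁ f') (g ⊠₁ g') (h ⊠₁ h')).inv =
      (α_ f g h).inv ⊠₂ (α_ f' g' h').inv ≫ (tensorComp (f ≫ g) h (f' ≫ g') h').hom ≫
        (tensorComp f g f' g').hom ▷ (h ⊠₁ h') := by
  rw [← cancel_epi (tensorIso (α_ f g h) (α_ f' g' h')).hom,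
    ← cancel_mono (α_ (f ⊠₁ f') (g ⊠₁ g') (h ⊠₁ h')).hom]
  simp only [Category.assoc, Iso.inv_hom_id, Category.comp_id, tensorComp_hom_associator_hom, tensorIso_hom]
  rw [reassoc_of% (tensorHom₂_hom_inv (α_ f g h) (α_ f' g' h'))]

lemma tensorComp_hom_leftUnitor {X X' Y Y' : B} (f : X ⟶ X') (g : Y ⟶ Y') :
    (tensorComp (𝟙 X) f (𝟙 Y) g).hom ≫ (tensorId X Y).hom ▷ (f ⊠₁ g) ≫ (λ_ (f ⊠₁ g)).hom =
      (λ_ f).hom ⊠₂ (λ_ g).hom :=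
  (leftUnitor_tensorHom₂_leftUnitor f g).symm

lemma tensorComp_hom_rightUnitor {X X' Y Y' : B} (f : X ⟶ X') (g : Y ⟶ Y') :
    (tensorComp f (𝟙 X') g (𝟙 Y')).hom ≫ f ⊠₁ g ◁ (tensorId X' Y').hom ≫ (ρ_ (f ⊠₁ g)).hom =
      (ρ_ f).hom ⊠₂ (ρ_ g).hom :=
  (rightUnitor_tensorHom₂_rightUnitor f g).symm

lemma adjTensorRight_counit {X X' : B} {f : X ⟶ X'} {g : X' ⟶ X} (adj : f ⊣ g) (Y : B) :
    (adjTensorRight adj Y).counit =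
      (rcomp g f Y).inv ≫ adj.counit ⊠₂ 𝟙 (𝟙 Y) ≫ (tensorId X' Y).hom := by
  -- The pseudofunctor `X ↦ (X, Y)` preserves identities strictly, so its unit constraint
  -- contributes nothing to the counit of the image adjunction.
  have h : (TensorBicategory.tensor (B := B)).map₂ ((Bicategory.Prod.sectL B Y).mapId X').hom =
      𝟙 (𝟙 X' ⊠₁ 𝟙 Y) :=
    (congrArg (fun t => (TensorBicategory.tensor (B := B)).map₂ (Iso.hom t))
      ((Bicategory.Prod.sectL B Y).mapId_eq_eqToIso X')).trans
      ((TensorBicategory.tensor (B := B)).map₂_id _)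
  exact congrArg (fun t => (rcomp g f Y).inv ≫ adj.counit ⊠₂ 𝟙 (𝟙 Y) ≫ t)
    ((congrArg (fun t => t ≫ (tensorId X' Y).hom) h).trans (Category.id_comp _))

/-- The 2-cell `g1 ≫ f1 ⟶ 1` induced by `g ≫ f ⟶ 1`. -/
def tensorCounit {X X' : B} {f : X ⟶ X'} {g : X' ⟶ X} (e : g ≫ f ⟶ 𝟙 X') (Y : B) :
    g ⊠₁ 𝟙 Y ≫ f ⊠₁ 𝟙 Y ⟶ 𝟙 (X' ⊠ Y) :=
  (rcomp g f Y).inv ≫ e ⊠₂ 𝟙 (𝟙 Y) ≫ (tensorId X' Y).hom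

/-- Up to composition constraints both sides are the tensor product of `e` with the identity of `h`,
so the counit passes through `1h` at the cost of two interchanges. No triangle identity is needed,
so `e` is arbitrary. -/
lemma interchange_tensorCounit {X X' Y Y' : B} {f : X ⟶ X'} {g : X' ⟶ X} (e : g ≫ f ⟶ 𝟙 X')
    (h : Y ⟶ Y') :
    g ⊠₁ 𝟙 Y ◁ (interchange f h).hom ≫ (α_ _ _ _).inv ≫ (interchange g h).hom ▷ (f ⊠₁ 𝟙 Y') ≫
      (α_ _ _ _).hom ≫ 𝟙 X' ⊠₁ h ◁ tensorCounit e Y' ≫ (ρ_ _).hom =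
    (α_ _ _ _).inv ≫ tensorCounit e Y ▷ (𝟙 X' ⊠₁ h) ≫ (λ_ _).hom := by
  rw [← cancel_epi (g ⊠₁ 𝟙 Y ◁ (tensorComp f (𝟙 X') (𝟙 Y) h).hom),
    ← cancel_epi (tensorComp g (f ≫ 𝟙 X') (𝟙 Y) (𝟙 Y ≫ h)).hom]
  simp only [interchange, tensorCounit, rcomp, Iso.trans_hom, Iso.trans_inv, Iso.symm_hom,
    Iso.symm_inv, Iso.refl_inv,
    tensorIso_hom, tensorIso_inv, whiskerLeft_comp, comp_whiskerRight, Category.assoc,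
    whiskerLeft_hom_inv_assoc, hom_inv_whiskerRight_assoc,
    reassoc_of% @tensorComp_hom_whiskerLeft, reassoc_of% @tensorComp_hom_whiskerRight,
    reassoc_of% @tensorComp_hom_associator_hom, reassoc_of% @tensorComp_hom_associator_inv,
    tensorComp_hom_leftUnitor, tensorComp_hom_rightUnitor, ← tensorHom₂_comp]
  -- Both sides are now a single tensor product followed by the same constraints; each factor is a
  -- coherence identity around `e` or around `h`.
  congr 1
  all_goals bicategory

lemma interchange_naturality_right {X X' Y Y' : B} (f : X ⟶ X') {g g' : Y ⟶ Y'} (η : g ⟶ g') :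
    (f ⊠₁ 𝟙 Y) ◁ (𝟙 (𝟙 X') ⊠₂ η) ≫ (interchange f g').hom =
      (interchange f g).hom ≫ (𝟙 (𝟙 X) ⊠₂ η) ▷ (f ⊠₁ 𝟙 Y') := by
  rw [← cancel_epi (tensorComp f (𝟙 X') (𝟙 Y) g).hom]
  simp only [interchange, Iso.trans_hom, Iso.symm_hom, tensorIso_hom, Category.assoc,
    reassoc_of% @tensorComp_hom_whiskerLeft, tensorComp_hom_whiskerRight, Iso.hom_inv_id_assoc]
  simp only [← Category.assoc, ← tensorHom₂_comp]
  congr 2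
  all_goals bicategory

end TensorCalculus

/-! ### Naturality and associativity of the one-sided composition constraints. -/

section TensorCalculus

variable {B : Type u} [Bicategory.{w, v} B] [TensorBicategory B]

instance isIso_tensorHom₂ {X X' Y Y' : B} {f f' : X ⟶ X'} {g g' : Y ⟶ Y'} (η : f ⟶ f') (θ : g ⟶ g') [IsIso η]
    [IsIso θ] : IsIso (η ⊠₂ θ) :=
  (tensorIso (asIso η) (asIso θ)).isIso_hom

lemma id_tensorHom₂_comp (A : B) {X Y : B} {f g h : X ⟶ Y} (η : f ⟶ g) (θ : g ⟶ h) :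
    𝟙 (𝟙 A) ⊠₂ (η ≫ θ) = 𝟙 (𝟙 A) ⊠₂ η ≫ 𝟙 (𝟙 A) ⊠₂ θ := by
  rw [← tensorHom₂_comp, Category.comp_id]

lemma tensorHom₂_id_comp (A : B) {X Y : B} {f g h : X ⟶ Y} (η : f ⟶ g) (θ : g ⟶ h) :
    (η ≫ θ) ⊠₂ 𝟙 (𝟙 A) = η ⊠₂ 𝟙 (𝟙 A) ≫ θ ⊠₂ 𝟙 (𝟙 A) := by
  rw [← tensorHom₂_comp, Category.comp_id]

lemma lcomp_naturality_left (A : B) {X Y Z : B} {f f' : X ⟶ Y} (η : f ⟶ f') (g : Y ⟶ Z) :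
    (lcomp A f g).hom ≫ (𝟙 (𝟙 A) ⊠₂ η) ▷ (𝟙 A ⊠₁ g) =
      𝟙 (𝟙 A) ⊠₂ (η ▷ g) ≫ (lcomp A f' g).hom := by
  simp only [lcomp, Iso.trans_hom, tensorIso_hom, Category.assoc, tensorComp_hom_whiskerRight]
  simp [← reassoc_of% @tensorHom₂_comp]

lemma lcomp_naturality_right (A : B) {X Y Z : B} (f : X ⟶ Y) {g g' : Y ⟶ Z} (η : g ⟶ g') :
    (lcomp A f g).hom ≫ 𝟙 A ⊠₁ f ◁ 𝟙 (𝟙 A) ⊠₂ η =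
      𝟙 (𝟙 A) ⊠₂ (f ◁ η) ≫ (lcomp A f g').hom := by
  simp only [lcomp, Iso.trans_hom, tensorIso_hom, Category.assoc, tensorComp_hom_whiskerLeft]
  simp [← reassoc_of% @tensorHom₂_comp]

lemma rcomp_naturality_left {X Y Z : B} {f f' : X ⟶ Y} (η : f ⟶ f') (g : Y ⟶ Z) (A : B) :
    (rcomp f g A).hom ≫ (η ⊠₂ 𝟙 (𝟙 A)) ▷ (g ⊠₁ 𝟙 A) =
      (η ▷ g) ⊠₂ 𝟙 (𝟙 A) ≫ (rcomp f' g A).hom := by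
  simp only [rcomp, Iso.trans_hom, tensorIso_hom, Category.assoc, tensorComp_hom_whiskerRight]
  simp [← reassoc_of% @tensorHom₂_comp]

lemma rcomp_naturality_right {X Y Z : B} (f : X ⟶ Y) {g g' : Y ⟶ Z} (η : g ⟶ g') (A : B) :
    (rcomp f g A).hom ≫ f ⊠₁ 𝟙 A ◁ η ⊠₂ 𝟙 (𝟙 A) =
      (f ◁ η) ⊠₂ 𝟙 (𝟙 A) ≫ (rcomp f g' A).hom := by
  simp only [rcomp, Iso.trans_hom, tensorIso_hom, Category.assoc, tensorComp_hom_whiskerLeft]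
  simp [← reassoc_of% @tensorHom₂_comp]

lemma rcomp_associator {X Y Z W : B} (f : X ⟶ Y) (g : Y ⟶ Z) (h : Z ⟶ W) (A : B) :
    (rcomp (f ≫ g) h A).hom ≫ (rcomp f g A).hom ▷ (h ⊠₁ 𝟙 A) ≫ (α_ _ _ _).hom =
      (α_ f g h).hom ⊠₂ 𝟙 (𝟙 A) ≫ (rcomp f (g ≫ h) A).hom ≫ f ⊠₁ 𝟙 A ◁ (rcomp g h A).hom := by
  simp only [rcomp, Iso.trans_hom, tensorIso_hom, Category.assoc, whiskerLeft_comp,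
    comp_whiskerRight, reassoc_of% @tensorComp_hom_whiskerRight,
    reassoc_of% @tensorComp_hom_whiskerLeft, tensorComp_hom_associator_hom]
  simp only [← reassoc_of% @tensorHom₂_comp]
  congr 1
  congr 1
  all_goals simp

lemma lcomp_inv_naturality_left (A : B) {X Y Z : B} {f f' : X ⟶ Y} (η : f ⟶ f') (g : Y ⟶ Z) :
    (lcomp A f g).inv ≫ 𝟙 (𝟙 A) ⊠₂ (η ▷ g) =
      (𝟙 (𝟙 A) ⊠₂ η) ▷ (𝟙 A ⊠₁ g) ≫ (lcomp A f' g).inv := by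
  rw [Iso.inv_comp_eq, ← Category.assoc, lcomp_naturality_left, Category.assoc, Iso.hom_inv_id,
    Category.comp_id]

lemma lcomp_inv_naturality_right (A : B) {X Y Z : B} (f : X ⟶ Y) {g g' : Y ⟶ Z} (η : g ⟶ g') :
    (lcomp A f g).inv ≫ 𝟙 (𝟙 A) ⊠₂ (f ◁ η) =
      𝟙 A ⊠₁ f ◁ 𝟙 (𝟙 A) ⊠₂ η ≫ (lcomp A f g').inv := by
  rw [Iso.inv_comp_eq, ← Category.assoc, lcomp_naturality_right, Category.assoc, Iso.hom_inv_id,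
    Category.comp_id]

lemma rcomp_inv_naturality_left {X Y Z : B} {f f' : X ⟶ Y} (η : f ⟶ f') (g : Y ⟶ Z) (A : B) :
    (rcomp f g A).inv ≫ (η ▷ g) ⊠₂ 𝟙 (𝟙 A) =
      (η ⊠₂ 𝟙 (𝟙 A)) ▷ (g ⊠₁ 𝟙 A) ≫ (rcomp f' g A).inv := by
  rw [Iso.inv_comp_eq, ← Category.assoc, rcomp_naturality_left, Category.assoc, Iso.hom_inv_id,
    Category.comp_id]

lemma rcomp_inv_naturality_right {X Y Z : B} (f : X ⟶ Y) {g g' : Y ⟶ Z} (η : g ⟶ g') (A : B) :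
    (rcomp f g A).inv ≫ (f ◁ η) ⊠₂ 𝟙 (𝟙 A) =
      f ⊠₁ 𝟙 A ◁ η ⊠₂ 𝟙 (𝟙 A) ≫ (rcomp f g' A).inv := by
  rw [Iso.inv_comp_eq, ← Category.assoc, rcomp_naturality_right, Category.assoc, Iso.hom_inv_id,
    Category.comp_id]

end TensorCalculus

/-! ### Pseudonaturality of the associativity and unit constraints, applied to counits. -/

section Naturality

variable {B : Type u} [Bicategory.{w, v} B] [MonoidalBicategory B]

open MonoidalBicategoryStruct MonoidalBicategory

lemma assocNat₂_inv_naturality (X : B) {Y Y' : B} {g g' : Y ⟶ Y'} (η : g ⟶ g') (Z : B) :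
    as X Y Z ◁ (𝟙 (𝟙 X) ⊠₂ (η ⊠₂ 𝟙 (𝟙 Z))) ≫ (assocNat₂ X g' Z).inv =
      (assocNat₂ X g Z).inv ≫ ((𝟙 (𝟙 X) ⊠₂ η) ⊠₂ 𝟙 (𝟙 Z)) ▷ as X Y' Z := by
  rw [Iso.comp_inv_eq, Category.assoc, Iso.eq_inv_comp]
  exact (assocNat_natural _ _ _).symm

lemma assocNat₃_inv_naturality (X Y : B) {Z Z' : B} {h h' : Z ⟶ Z'} (η : h ⟶ h') :
    as X Y Z ◁ (𝟙 (𝟙 X) ⊠₂ (𝟙 (𝟙 Y) ⊠₂ η)) ≫ (assocNat₃ X Y h').inv =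
      (assocNat₃ X Y h).inv ≫ (𝟙 (𝟙 (X ⊠ Y)) ⊠₂ η) ▷ as X Y Z' := by
  rw [Iso.comp_inv_eq, Category.assoc, Iso.eq_inv_comp]
  simp only [assocNat₃, Iso.trans_hom, whiskerRightIso_hom, Category.assoc]
  rw [← assocNat_natural, tensorHom₂_id, ← comp_whiskerRight_assoc, ← comp_whiskerRight_assoc]
  simp only [tensorIso_hom, ← tensorHom₂_comp]
  simp

/-- Naturality of `rightNat` at `e`, with its value at `g ≫ f` split by the composition law and its
value at the identity 1-cell given by the unit law. -/
lemma rightNat_tensorCounit {X X' : B} {f : X ⟶ X'} {g : X' ⟶ X} (e : g ≫ f ⟶ 𝟙 X') :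
    g ⊠₁ 𝟙 (tensorI B) ◁ (rightNat f).hom ≫ (α_ _ _ _).inv ≫ (rightNat g).hom ▷ f ≫
      (α_ _ _ _).hom ≫ ru X' ◁ e ≫ (ρ_ _).hom =
    (α_ _ _ _).inv ≫ tensorCounit e (tensorI B) ▷ ru X' ≫ (λ_ _).hom := by
  have h := congrArg Iso.hom (rightNat_comp g f)
  have h' := rightNat_natural e
  have h₀ := congrArg Iso.hom (rightNat_id X')
  simp only [sqComp', sqId, Iso.trans_hom, whiskerRightIso_hom, whiskerLeftIso_hom, Iso.symm_hom,
    Iso.trans_symm, Iso.symm_symm_eq] at h h₀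
  rw [h, h₀] at h'
  rw [← cancel_epi (α_ (g ⊠₁ 𝟙 (tensorI B)) (f ⊠₁ 𝟙 (tensorI B)) (ru X')).hom,
    ← cancel_epi ((rcomp g f (tensorI B)).hom ▷ ru X')]
  simp only [tensorCounit, comp_whiskerRight, Category.assoc, Iso.hom_inv_id_assoc,
    hom_inv_whiskerRight_assoc] at h' ⊢
  rw [← reassoc_of% h']
  simp

/-- The same argument for the associativity constraint in its first variable. The extra work lies in
the identities `𝟙 Y`, `𝟙 Z` in the other two variables, whose constraints `tensorId` and
`tensorComp` must be absorbed. -/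
lemma assocNat₁_tensorCounit {X X' : B} {f : X ⟶ X'} {g : X' ⟶ X} (e : g ≫ f ⟶ 𝟙 X') (Y Z : B) :
    (g ⊠₁ 𝟙 Y) ⊠₁ 𝟙 Z ◁ (assocNat₁ f Y Z).hom ≫ (α_ _ _ _).inv ≫
      (assocNat₁ g Y Z).hom ▷ (f ⊠₁ 𝟙 (Y ⊠ Z)) ≫ (α_ _ _ _).hom ≫
        as X' Y Z ◁ tensorCounit e (Y ⊠ Z) ≫ (ρ_ _).hom =
    (α_ _ _ _).inv ≫ tensorCounit (tensorCounit e Y) Z ▷ as X' Y Z ≫ (λ_ _).hom := by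
  have h := congrArg Iso.hom (assocNat_comp g f (𝟙 Y) (𝟙 Y) (𝟙 Z) (𝟙 Z))
  -- The composition law produces `𝟙 ≫ 𝟙` in the last two variables; the unitors contract these
  -- while `e` acts in the first.
  have h' := assocNat_natural e (λ_ (𝟙 Y)).hom (λ_ (𝟙 Z)).hom
  have h₀ := congrArg Iso.hom (assocNat_id X' Y Z)
  -- The `tensorId` cells hidden in `assocNat₁` are collected at the end, leaving the pasting that
  -- the composition law describes.
  have h₁ : (g ⊠₁ 𝟙 Y) ⊠₁ 𝟙 Z ◁ (assocNat₁ f Y Z).hom ≫ (α_ _ _ _).inv ≫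
      (assocNat₁ g Y Z).hom ▷ (f ⊠₁ 𝟙 (Y ⊠ Z)) ≫ (α_ _ _ _).hom =
      (α_ _ _ _).inv ≫ (sqComp' (assocNat g (𝟙 Y) (𝟙 Z)) (assocNat f (𝟙 Y) (𝟙 Z))).hom ≫
      as X' Y Z ◁ ((𝟙 g ⊠₂ (tensorId Y Z).hom) ▷ _ ≫ _ ◁ (𝟙 f ⊠₂ (tensorId Y Z).hom)) := by
    calc
      _ = (g ⊠₁ 𝟙 Y) ⊠₁ 𝟙 Z ◁ (assocNat f (𝟙 Y) (𝟙 Z)).hom ⊗≫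
            (((g ⊠₁ 𝟙 Y) ⊠₁ 𝟙 Z ≫ as X Y Z) ◁ (𝟙 f ⊠₂ (tensorId Y Z).hom) ≫
              (assocNat g (𝟙 Y) (𝟙 Z)).hom ▷ (f ⊠₁ 𝟙 (Y ⊠ Z))) ⊗≫
            as X' Y Z ◁ (𝟙 g ⊠₂ (tensorId Y Z).hom) ▷ (f ⊠₁ 𝟙 (Y ⊠ Z)) ⊗≫ 𝟙 _ := by
        simp only [assocNat₁, Iso.trans_hom, whiskerLeftIso_hom, tensorIso_hom, Iso.refl_hom]
        bicategory
      _ = (g ⊠₁ 𝟙 Y) ⊠₁ 𝟙 Z ◁ (assocNat f (𝟙 Y) (𝟙 Z)).hom ⊗≫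
            (assocNat g (𝟙 Y) (𝟙 Z)).hom ▷ (f ⊠₁ (𝟙 Y ⊠₁ 𝟙 Z)) ⊗≫
            as X' Y Z ◁ (g ⊠₁ (𝟙 Y ⊠₁ 𝟙 Z) ◁ (𝟙 f ⊠₂ (tensorId Y Z).hom) ≫
              (𝟙 g ⊠₂ (tensorId Y Z).hom) ▷ (f ⊠₁ 𝟙 (Y ⊠ Z))) ⊗≫ 𝟙 _ := by
        rw [whisker_exchange]
        bicategory
      _ = _ := by
        rw [whisker_exchange]
        simp only [sqComp', Iso.trans_hom, whiskerLeftIso_hom, whiskerRightIso_hom, Iso.symm_hom]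
        bicategory
  have h₂ : 𝟙 (g ≫ f) ⊠₂ (tensorComp (𝟙 Y) (𝟙 Y) (𝟙 Z) (𝟙 Z)).hom ≫
      (tensorComp g f (𝟙 Y ⊠₁ 𝟙 Z) (𝟙 Y ⊠₁ 𝟙 Z)).hom ≫
      (𝟙 g ⊠₂ (tensorId Y Z).hom) ▷ (f ⊠₁ (𝟙 Y ⊠₁ 𝟙 Z)) ≫
        g ⊠₁ 𝟙 (Y ⊠ Z) ◁ (𝟙 f ⊠₂ (tensorId Y Z).hom) ≫ tensorCounit e (Y ⊠ Z) =
      e ⊠₂ ((λ_ (𝟙 Y)).hom ⊠₂ (λ_ (𝟙 Z)).hom) ≫ 𝟙 (𝟙 X') ⊠₂ (tensorId Y Z).hom ≫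
        (tensorId X' (Y ⊠ Z)).hom := by
    simp only [tensorCounit, rcomp, Iso.trans_inv, Category.assoc,
      reassoc_of% @tensorComp_hom_whiskerRight, reassoc_of% @tensorComp_hom_whiskerLeft,
      Iso.hom_inv_id_assoc, tensorIso_inv, Iso.refl_inv, Iso.symm_inv]
    simp only [← reassoc_of% @tensorHom₂_comp]
    simp [reassoc_of% @tensorComp_hom_leftUnitor, unitors_equal]
  have h₃ : (tensorComp g f (𝟙 Y) (𝟙 Y)).hom ⊠₂ 𝟙 (𝟙 Z ≫ 𝟙 Z) ≫
      (tensorComp (g ⊠₁ 𝟙 Y) (f ⊠₁ 𝟙 Y) (𝟙 Z) (𝟙 Z)).hom ≫ tensorCounit (tensorCounit e Y) Z =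
      (e ⊠₂ (λ_ (𝟙 Y)).hom) ⊠₂ (λ_ (𝟙 Z)).hom ≫ (tensorId X' Y).hom ⊠₂ 𝟙 (𝟙 Z) ≫
        (tensorId (X' ⊠ Y) Z).hom := by
    simp only [tensorCounit, rcomp, Iso.trans_inv, Category.assoc, Iso.hom_inv_id_assoc,
      tensorIso_inv, Iso.refl_inv, Iso.symm_inv]
    simp only [← reassoc_of% @tensorHom₂_comp]
    simp
  simp only [Iso.trans_hom, whiskerRightIso_hom, whiskerLeftIso_hom, Iso.symm_hom, sqId,
    Iso.trans_inv, Iso.symm_inv, comp_whiskerRight, whiskerLeft_comp, Category.assoc,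
    tensorIso_hom, tensorIso_inv, Iso.refl_hom, Iso.refl_inv] at h h₀ h₁
  have h₄ : ((tensorComp g f (𝟙 Y) (𝟙 Y)).hom ⊠₂ 𝟙 (𝟙 Z ≫ 𝟙 Z)) ▷ as X' Y Z ≫
      (tensorComp (g ⊠₁ 𝟙 Y) (f ⊠₁ 𝟙 Y) (𝟙 Z) (𝟙 Z)).hom ▷ as X' Y Z ≫
      (sqComp' (assocNat g (𝟙 Y) (𝟙 Z)) (assocNat f (𝟙 Y) (𝟙 Z))).hom =
      (assocNat (g ≫ f) (𝟙 Y ≫ 𝟙 Y) (𝟙 Z ≫ 𝟙 Z)).hom ≫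
        as X' Y Z ◁ (𝟙 (g ≫ f) ⊠₂ (tensorComp (𝟙 Y) (𝟙 Y) (𝟙 Z) (𝟙 Z)).hom) ≫
        as X' Y Z ◁ (tensorComp g f (𝟙 Y ⊠₁ 𝟙 Z) (𝟙 Y ⊠₁ 𝟙 Z)).hom := by
    rw [h]
    simp only [Category.assoc, ← reassoc_of% @tensorHom₂_comp, Iso.inv_hom_id, tensorHom₂_id, whiskerLeft_id, Category.id_comp, ← whiskerLeft_comp, Category.comp_id]
  rw [reassoc_of% h₁, cancel_epi,
    ← cancel_epi ((tensorComp (g ⊠₁ 𝟙 Y) (f ⊠₁ 𝟙 Y) (𝟙 Z) (𝟙 Z)).hom ▷ as X' Y Z),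
    ← cancel_epi (((tensorComp g f (𝟙 Y) (𝟙 Y)).hom ⊠₂ 𝟙 (𝟙 Z ≫ 𝟙 Z)) ▷ as X' Y Z),
    reassoc_of% h₄]
  simp only [← whiskerLeft_comp_assoc, ← comp_whiskerRight_assoc, h₂, h₃]
  rw [whiskerLeft_comp_assoc, ← reassoc_of% h', h₀]
  simp only [Category.assoc, ← whiskerLeft_comp_assoc, Iso.inv_hom_id,
    ← reassoc_of% @tensorHom₂_comp, ← comp_whiskerRight_assoc]
  simp [tensorHom₂_id]

end Naturality

/-! ### Restriction of an oplax action along a morphism of skew structures. -/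

section Restriction

variable {B : Type u} [Bicategory.{w, v} B] [MonoidalBicategory B]

open MonoidalBicategoryStruct MonoidalBicategory

namespace OplaxActionData

variable {M : RightSkewMonoidaleData B} {A : B} (a : OplaxActionData M A)

/-- The restriction of an oplax action along a 2-cell `κ : n ⟶ m` to the product of `M`. -/
def restrict {n : M.obj ⊠ M.obj ⟶ M.obj} (κ : n ⟶ M.mul)
    (assocCell : as M.obj M.obj M.obj ≫ 𝟙 M.obj ⊠₁ n ≫ n ⟶ n ⊠₁ 𝟙 M.obj ≫ n)
    (leftCell : lu M.obj ⟶ M.one ⊠₁ 𝟙 M.obj ≫ n)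
    (rightCell : 𝟙 M.obj ⊠₁ M.one ≫ n ⟶ ru M.obj) :
    OplaxActionData ⟨M.obj, n, M.one, assocCell, leftCell, rightCell⟩ A where
  act := a.act
  actAssoc := as A M.obj M.obj ◁ (𝟙 (𝟙 A) ⊠₂ κ) ▷ a.act ≫ a.actAssoc
  actUnit := a.actUnit

variable {n : M.obj ⊠ M.obj ⟶ M.obj} (κ : n ⟶ M.mul)
    (assocCell : as M.obj M.obj M.obj ≫ 𝟙 M.obj ⊠₁ n ≫ n ⟶ n ⊠₁ 𝟙 M.obj ≫ n)
    (leftCell : lu M.obj ⟶ M.one ⊠₁ 𝟙 M.obj ≫ n)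
    (rightCell : 𝟙 M.obj ⊠₁ M.one ≫ n ⟶ ru M.obj)

/-- The only `κ` sits in the associator of the action; it slides back past `assocNat₂` and is
absorbed by the left unitor. -/
lemma restrict_triangleLeft (h : leftCell ≫ M.one ⊠₁ 𝟙 M.obj ◁ κ = M.leftCell) :
    (a.restrict κ assocCell leftCell rightCell).triangleLeft = a.triangleLeft := by
  obtain ⟨R, m, u, α, l, r⟩ := M
  obtain ⟨act, α₂, α₀⟩ := a
  dsimp only at *
  simp only [triangleLeft, restrict]
  have h₁ : (𝟙 (𝟙 A) ⊠₂ leftCell ≫ (lcomp A (u ⊠₁ 𝟙 R) n).hom) ≫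
      𝟙 A ⊠₁ (u ⊠₁ 𝟙 R) ◁ (𝟙 (𝟙 A) ⊠₂ κ) =
      𝟙 (𝟙 A) ⊠₂ l ≫ (lcomp A (u ⊠₁ 𝟙 R) m).hom := by
    rw [Category.assoc, lcomp_naturality_right, ← h, id_tensorHom₂_comp, Category.assoc]
  rw [← h₁]
  generalize (𝟙 (𝟙 A) ⊠₂ leftCell ≫ (lcomp A (u ⊠₁ 𝟙 R) n).hom) = x
  generalize ((rcomp (𝟙 A ⊠₁ u) act R).inv ≫ α₀ ⊠₂ 𝟙 (𝟙 R)) = y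
  calc
    _ = as A (tensorI B) R ◁ x ▷ act ⊗≫
          ((assocNat₂ A u R).inv ▷ (𝟙 A ⊠₁ n) ≫ _ ◁ (𝟙 (𝟙 A) ⊠₂ κ)) ▷ act ⊗≫
          (𝟙 A ⊠₁ u) ⊠₁ 𝟙 R ◁ α₂ ⊗≫ y ▷ act := by bicategory
    _ = _ := by
      rw [← whisker_exchange]
      bicategory

lemma restrict_rightUnitLeft (h : 𝟙 M.obj ⊠₁ M.one ◁ κ ≫ M.rightCell = rightCell) :
    (a.restrict κ assocCell leftCell rightCell).rightUnitLeft =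
      (as A M.obj (tensorI B) ◁ 𝟙 A ⊠₁ (𝟙 M.obj ⊠₁ M.one) ◁ (𝟙 (𝟙 A) ⊠₂ κ) ▷ a.act) ≫
        a.rightUnitLeft := by
  obtain ⟨R, m, u, α, l, r⟩ := M
  obtain ⟨act, α₂, α₀⟩ := a
  dsimp only at *
  simp only [rightUnitLeft, restrict]
  rw [← h, id_tensorHom₂_comp, reassoc_of% @lcomp_inv_naturality_right]
  bicategory

lemma restrict_rightUnitRight :
    (a.restrict κ assocCell leftCell rightCell).rightUnitRight =
      (as A M.obj (tensorI B) ◁ 𝟙 A ⊠₁ (𝟙 M.obj ⊠₁ M.one) ◁ (𝟙 (𝟙 A) ⊠₂ κ) ▷ a.act) ≫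
        a.rightUnitRight := by
  obtain ⟨R, m, u, α, l, r⟩ := M
  obtain ⟨act, α₂, α₀⟩ := a
  dsimp only at *
  simp only [rightUnitRight, restrict]
  calc
    _ = 𝟙 _ ⊗≫ ((assocNat₃ A R u).inv ▷ (𝟙 A ⊠₁ n) ≫ _ ◁ (𝟙 (𝟙 A) ⊠₂ κ)) ▷ act ⊗≫
          𝟙 (A ⊠ R) ⊠₁ u ◁ α₂ ⊗≫ (interchange act u).inv ▷ act ⊗≫
          act ⊠₁ 𝟙 (tensorI B) ◁ α₀ ≫ (rightNat act).hom := by bicategory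
    _ = _ := by
      rw [← whisker_exchange]
      bicategory

/-- Each of the two action associators contributes one `κ`, and both reach the front by naturality
of the constraints alone. -/
lemma restrict_pentagonLeft :
    (a.restrict κ assocCell leftCell rightCell).pentagonLeft =
      ((as (A ⊠ M.obj) M.obj M.obj ≫ as A M.obj (M.obj ⊠ M.obj)) ◁
        ((𝟙 (𝟙 A) ⊠₂ (𝟙 (𝟙 M.obj) ⊠₂ κ)) ▷ (𝟙 A ⊠₁ n ≫ a.act) ≫
          𝟙 A ⊠₁ (𝟙 M.obj ⊠₁ M.mul) ◁ (𝟙 (𝟙 A) ⊠₂ κ) ▷ a.act)) ≫ a.pentagonLeft := by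
  obtain ⟨R, m, u, α, l, r⟩ := M
  obtain ⟨act, α₂, α₀⟩ := a
  dsimp only at *
  simp only [pentagonLeft, restrict]
  -- Needed for the `κ` of the second associator, which must cross the interchange of `act` with the
  -- product.
  have hI : (interchange act n).inv ≫ act ⊠₁ 𝟙 (R ⊠ R) ◁ (𝟙 (𝟙 A) ⊠₂ κ) =
      (𝟙 (𝟙 (A ⊠ R)) ⊠₂ κ) ▷ (act ⊠₁ 𝟙 R) ≫ (interchange act m).inv := by
    rw [Iso.inv_comp_eq, ← Category.assoc, ← interchange_naturality_right]
    simp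
  calc
    _ = 𝟙 _ ⊗≫ as (A ⊠ R) R R ◁ ((assocNat₃ A R n).inv ▷ (𝟙 A ⊠₁ n) ≫
            _ ◁ (𝟙 (𝟙 A) ⊠₂ κ)) ▷ act ⊗≫
          (as (A ⊠ R) R R ≫ 𝟙 (A ⊠ R) ⊠₁ n) ◁ α₂ ⊗≫
          as (A ⊠ R) R R ◁ (interchange act n).inv ▷ act ⊗≫
          ((assocNat₁ act R R).inv ▷ (𝟙 A ⊠₁ n) ≫ _ ◁ (𝟙 (𝟙 A) ⊠₂ κ)) ▷ act ⊗≫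
          (act ⊠₁ 𝟙 R) ⊠₁ 𝟙 R ◁ α₂ := by bicategory
    _ = 𝟙 _ ⊗≫ (as (A ⊠ R) R R ≫ as A R (R ⊠ R) ≫ 𝟙 A ⊠₁ (𝟙 R ⊠₁ n)) ◁
            (𝟙 (𝟙 A) ⊠₂ κ) ▷ act ⊗≫
          as (A ⊠ R) R R ◁ (assocNat₃ A R n).inv ▷ (𝟙 A ⊠₁ m) ▷ act ⊗≫
          (as (A ⊠ R) R R ≫ 𝟙 (A ⊠ R) ⊠₁ n) ◁ α₂ ⊗≫
          as (A ⊠ R) R R ◁ ((interchange act n).inv ≫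
            act ⊠₁ 𝟙 (R ⊠ R) ◁ (𝟙 (𝟙 A) ⊠₂ κ)) ▷ act ⊗≫
          (assocNat₁ act R R).inv ▷ (𝟙 A ⊠₁ m) ▷ act ⊗≫
          (act ⊠₁ 𝟙 R) ⊠₁ 𝟙 R ◁ α₂ := by
      rw [← whisker_exchange, ← whisker_exchange]
      bicategory
    _ = 𝟙 _ ⊗≫ (as (A ⊠ R) R R ≫ as A R (R ⊠ R) ≫ 𝟙 A ⊠₁ (𝟙 R ⊠₁ n)) ◁
            (𝟙 (𝟙 A) ⊠₂ κ) ▷ act ⊗≫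
          as (A ⊠ R) R R ◁ (assocNat₃ A R n).inv ▷ (𝟙 A ⊠₁ m) ▷ act ⊗≫
          as (A ⊠ R) R R ◁ (𝟙 (A ⊠ R) ⊠₁ n ◁ α₂ ≫ (𝟙 (𝟙 (A ⊠ R)) ⊠₂ κ) ▷ _) ⊗≫
          as (A ⊠ R) R R ◁ (interchange act m).inv ▷ act ⊗≫
          (assocNat₁ act R R).inv ▷ (𝟙 A ⊠₁ m) ▷ act ⊗≫
          (act ⊠₁ 𝟙 R) ⊠₁ 𝟙 R ◁ α₂ := by
      rw [hI]
      bicategory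
    _ = 𝟙 _ ⊗≫ (as (A ⊠ R) R R ≫ as A R (R ⊠ R) ≫ 𝟙 A ⊠₁ (𝟙 R ⊠₁ n)) ◁
            (𝟙 (𝟙 A) ⊠₂ κ) ▷ act ⊗≫
          as (A ⊠ R) R R ◁ ((assocNat₃ A R n).inv ≫
            (𝟙 (𝟙 (A ⊠ R)) ⊠₂ κ) ▷ as A R R) ▷ (𝟙 A ⊠₁ m) ▷ act ⊗≫
          (as (A ⊠ R) R R ≫ 𝟙 (A ⊠ R) ⊠₁ m) ◁ α₂ ⊗≫
          as (A ⊠ R) R R ◁ (interchange act m).inv ▷ act ⊗≫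
          (assocNat₁ act R R).inv ▷ (𝟙 A ⊠₁ m) ▷ act ⊗≫
          (act ⊠₁ 𝟙 R) ⊠₁ 𝟙 R ◁ α₂ := by
      rw [whisker_exchange]
      bicategory
    _ = 𝟙 _ ⊗≫ (as (A ⊠ R) R R ≫ as A R (R ⊠ R)) ◁ (𝟙 A ⊠₁ (𝟙 R ⊠₁ n) ◁
            (𝟙 (𝟙 A) ⊠₂ κ) ≫ (𝟙 (𝟙 A) ⊠₂ (𝟙 (𝟙 R) ⊠₂ κ)) ▷ (𝟙 A ⊠₁ m)) ▷ act ⊗≫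
          as (A ⊠ R) R R ◁ (assocNat₃ A R m).inv ▷ (𝟙 A ⊠₁ m) ▷ act ⊗≫
          (as (A ⊠ R) R R ≫ 𝟙 (A ⊠ R) ⊠₁ m) ◁ α₂ ⊗≫
          as (A ⊠ R) R R ◁ (interchange act m).inv ▷ act ⊗≫
          (assocNat₁ act R R).inv ▷ (𝟙 A ⊠₁ m) ▷ act ⊗≫
          (act ⊠₁ 𝟙 R) ⊠₁ 𝟙 R ◁ α₂ := by
      rw [← assocNat₃_inv_naturality]
      bicategory
    _ = _ := by
      rw [whisker_exchange]
      bicategory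

/-- The two copies of `κ` slide back only as far as the associator of the restricted skew structure;
the hypothesis carries them across it. The prefix that results is the one in
`restrict_pentagonLeft`, so the pentagon of `a` finishes the comparison. -/
lemma restrict_pentagonRight
    (h : assocCell ≫ (κ ⊠₂ 𝟙 (𝟙 M.obj)) ▷ n ≫ M.mul ⊠₁ 𝟙 M.obj ◁ κ =
      as M.obj M.obj M.obj ◁ (𝟙 (𝟙 M.obj) ⊠₂ κ) ▷ n ≫
        as M.obj M.obj M.obj ◁ 𝟙 M.obj ⊠₁ M.mul ◁ κ ≫ M.assocCell) :
    (a.restrict κ assocCell leftCell rightCell).pentagonRight =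
      ((as (A ⊠ M.obj) M.obj M.obj ≫ as A M.obj (M.obj ⊠ M.obj)) ◁
        ((𝟙 (𝟙 A) ⊠₂ (𝟙 (𝟙 M.obj) ⊠₂ κ)) ▷ (𝟙 A ⊠₁ n ≫ a.act) ≫
          𝟙 A ⊠₁ (𝟙 M.obj ⊠₁ M.mul) ◁ (𝟙 (𝟙 A) ⊠₂ κ) ▷ a.act)) ≫ a.pentagonRight := by
  obtain ⟨R, m, u, α, l, r⟩ := M
  obtain ⟨act, α₂, α₀⟩ := a
  dsimp only at *
  simp only [pentagonRight, restrict]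
  have h₁ : as A R R ⊠₁ 𝟙 R ◁ (rcomp (𝟙 A ⊠₁ n) act R).inv ≫
      (rcomp (as A R R) (𝟙 A ⊠₁ n ≫ act) R).inv ≫
      (as A R R ◁ (𝟙 (𝟙 A) ⊠₂ κ) ▷ act ≫ α₂) ⊠₂ 𝟙 (𝟙 R) ≫ (rcomp (act ⊠₁ 𝟙 R) act R).hom =
      as A R R ⊠₁ 𝟙 R ◁ ((𝟙 (𝟙 A) ⊠₂ κ) ⊠₂ 𝟙 (𝟙 R)) ▷ (act ⊠₁ 𝟙 R) ≫
      as A R R ⊠₁ 𝟙 R ◁ (rcomp (𝟙 A ⊠₁ m) act R).inv ≫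
      (rcomp (as A R R) (𝟙 A ⊠₁ m ≫ act) R).inv ≫
      α₂ ⊠₂ 𝟙 (𝟙 R) ≫ (rcomp (act ⊠₁ 𝟙 R) act R).hom := by
    simp only [tensorHom₂_id_comp, Category.assoc, reassoc_of% @rcomp_inv_naturality_right,
      ← whiskerLeft_comp_assoc, rcomp_inv_naturality_left]
  -- The hypothesis `h` tensored on the left with `A`.
  have h₂ : (𝟙 A ⊠₁ as R R R ◁ (lcomp A (𝟙 R ⊠₁ n) n).inv ≫
        (lcomp A (as R R R) (𝟙 R ⊠₁ n ≫ n)).inv ≫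
        𝟙 (𝟙 A) ⊠₂ assocCell ≫ (lcomp A (n ⊠₁ 𝟙 R) n).hom) ≫
        (𝟙 (𝟙 A) ⊠₂ (κ ⊠₂ 𝟙 (𝟙 R))) ▷ (𝟙 A ⊠₁ n) ≫ 𝟙 A ⊠₁ (m ⊠₁ 𝟙 R) ◁ (𝟙 (𝟙 A) ⊠₂ κ) =
      𝟙 A ⊠₁ as R R R ◁ ((𝟙 (𝟙 A) ⊠₂ (𝟙 (𝟙 R) ⊠₂ κ)) ▷ (𝟙 A ⊠₁ n) ≫
        𝟙 A ⊠₁ (𝟙 R ⊠₁ m) ◁ (𝟙 (𝟙 A) ⊠₂ κ)) ≫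
      𝟙 A ⊠₁ as R R R ◁ (lcomp A (𝟙 R ⊠₁ m) m).inv ≫
        (lcomp A (as R R R) (𝟙 R ⊠₁ m ≫ m)).inv ≫
        𝟙 (𝟙 A) ⊠₂ α ≫ (lcomp A (m ⊠₁ 𝟙 R) m).hom := by
    simp only [Category.assoc, reassoc_of% @lcomp_naturality_left, lcomp_naturality_right]
    simp only [← reassoc_of% @id_tensorHom₂_comp, h]
    simp only [id_tensorHom₂_comp, Category.assoc, reassoc_of% @lcomp_inv_naturality_right,
      ← whiskerLeft_comp_assoc, reassoc_of% @lcomp_inv_naturality_left,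
      lcomp_inv_naturality_right]
  rw [h₁]
  -- These composites become atoms, so that `bicategory` only has to rebracket around them.
  generalize as A R R ⊠₁ 𝟙 R ◁ (rcomp (𝟙 A ⊠₁ m) act R).inv ≫
      (rcomp (as A R R) (𝟙 A ⊠₁ m ≫ act) R).inv ≫
      α₂ ⊠₂ 𝟙 (𝟙 R) ≫ (rcomp (act ⊠₁ 𝟙 R) act R).hom = y
  generalize 𝟙 A ⊠₁ as R R R ◁ (lcomp A (𝟙 R ⊠₁ n) n).inv ≫
        (lcomp A (as R R R) (𝟙 R ⊠₁ n ≫ n)).inv ≫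
        𝟙 (𝟙 A) ⊠₂ assocCell ≫ (lcomp A (n ⊠₁ 𝟙 R) n).hom = x at *
  generalize 𝟙 A ⊠₁ as R R R ◁ (lcomp A (𝟙 R ⊠₁ m) m).inv ≫
        (lcomp A (as R R R) (𝟙 R ⊠₁ m ≫ m)).inv ≫
        𝟙 (𝟙 A) ⊠₂ α ≫ (lcomp A (m ⊠₁ 𝟙 R) m).hom = x' at *
  calc
    _ = (pent A R R R).inv ▷ (𝟙 A ⊠₁ (𝟙 R ⊠₁ n) ≫ 𝟙 A ⊠₁ n ≫ act) ⊗≫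
        (as A R R ⊠₁ 𝟙 R ≫ as A (R ⊠ R) R) ◁ x ▷ act ⊗≫
        as A R R ⊠₁ 𝟙 R ◁ ((assocNat₂ A n R).inv ▷ (𝟙 A ⊠₁ n) ≫ _ ◁ (𝟙 (𝟙 A) ⊠₂ κ)) ▷ act ⊗≫
        as A R R ⊠₁ 𝟙 R ◁ ((𝟙 A ⊠₁ n) ⊠₁ 𝟙 R ◁ α₂ ≫
          ((𝟙 (𝟙 A) ⊠₂ κ) ⊠₂ 𝟙 (𝟙 R)) ▷ (act ⊠₁ 𝟙 R ≫ act)) ⊗≫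
        y ▷ act ⊗≫ 𝟙 _ := by bicategory
    _ = (pent A R R R).inv ▷ (𝟙 A ⊠₁ (𝟙 R ⊠₁ n) ≫ 𝟙 A ⊠₁ n ≫ act) ⊗≫
        (as A R R ⊠₁ 𝟙 R ≫ as A (R ⊠ R) R) ◁ x ▷ act ⊗≫
        (as A R R ⊠₁ 𝟙 R ≫ as A (R ⊠ R) R ≫ 𝟙 A ⊠₁ (n ⊠₁ 𝟙 R)) ◁ (𝟙 (𝟙 A) ⊠₂ κ) ▷ act ⊗≫
        as A R R ⊠₁ 𝟙 R ◁ ((assocNat₂ A n R).inv ≫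
          ((𝟙 (𝟙 A) ⊠₂ κ) ⊠₂ 𝟙 (𝟙 R)) ▷ as A R R) ▷ (𝟙 A ⊠₁ m) ▷ act ⊗≫
        as A R R ⊠₁ 𝟙 R ◁ (𝟙 A ⊠₁ m) ⊠₁ 𝟙 R ◁ α₂ ⊗≫
        y ▷ act ⊗≫ 𝟙 _ := by
      rw [← whisker_exchange, whisker_exchange ((𝟙 (𝟙 A) ⊠₂ κ) ⊠₂ 𝟙 (𝟙 R)) α₂]
      bicategory
    _ = (pent A R R R).inv ▷ (𝟙 A ⊠₁ (𝟙 R ⊠₁ n) ≫ 𝟙 A ⊠₁ n ≫ act) ⊗≫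
        (as A R R ⊠₁ 𝟙 R ≫ as A (R ⊠ R) R) ◁ x ▷ act ⊗≫
        (as A R R ⊠₁ 𝟙 R ≫ as A (R ⊠ R) R) ◁ (𝟙 A ⊠₁ (n ⊠₁ 𝟙 R) ◁ (𝟙 (𝟙 A) ⊠₂ κ) ≫
          (𝟙 (𝟙 A) ⊠₂ (κ ⊠₂ 𝟙 (𝟙 R))) ▷ (𝟙 A ⊠₁ m)) ▷ act ⊗≫
        as A R R ⊠₁ 𝟙 R ◁ (assocNat₂ A m R).inv ▷ (𝟙 A ⊠₁ m) ▷ act ⊗≫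
        as A R R ⊠₁ 𝟙 R ◁ (𝟙 A ⊠₁ m) ⊠₁ 𝟙 R ◁ α₂ ⊗≫
        y ▷ act ⊗≫ 𝟙 _ := by
      rw [← assocNat₂_inv_naturality]
      bicategory
    _ = (pent A R R R).inv ▷ (𝟙 A ⊠₁ (𝟙 R ⊠₁ n) ≫ 𝟙 A ⊠₁ n ≫ act) ⊗≫
        (as A R R ⊠₁ 𝟙 R ≫ as A (R ⊠ R) R) ◁ (x ≫
        (𝟙 (𝟙 A) ⊠₂ (κ ⊠₂ 𝟙 (𝟙 R))) ▷ (𝟙 A ⊠₁ n) ≫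
          𝟙 A ⊠₁ (m ⊠₁ 𝟙 R) ◁ (𝟙 (𝟙 A) ⊠₂ κ)) ▷ act ⊗≫
        as A R R ⊠₁ 𝟙 R ◁ (assocNat₂ A m R).inv ▷ (𝟙 A ⊠₁ m) ▷ act ⊗≫
        as A R R ⊠₁ 𝟙 R ◁ (𝟙 A ⊠₁ m) ⊠₁ 𝟙 R ◁ α₂ ⊗≫
        y ▷ act ⊗≫ 𝟙 _ := by
      rw [whisker_exchange]
      bicategory
    _ = 𝟙 _ ⊗≫ ((pent A R R R).inv ▷ (𝟙 A ⊠₁ (𝟙 R ⊠₁ n) ≫ 𝟙 A ⊠₁ n) ≫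
        _ ◁ ((𝟙 (𝟙 A) ⊠₂ (𝟙 (𝟙 R) ⊠₂ κ)) ▷ (𝟙 A ⊠₁ n) ≫
          𝟙 A ⊠₁ (𝟙 R ⊠₁ m) ◁ (𝟙 (𝟙 A) ⊠₂ κ))) ▷ act ⊗≫
        (as A R R ⊠₁ 𝟙 R ≫ as A (R ⊠ R) R) ◁ x' ▷ act ⊗≫
        as A R R ⊠₁ 𝟙 R ◁ (assocNat₂ A m R).inv ▷ (𝟙 A ⊠₁ m) ▷ act ⊗≫
        as A R R ⊠₁ 𝟙 R ◁ (𝟙 A ⊠₁ m) ⊠₁ 𝟙 R ◁ α₂ ⊗≫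
        y ▷ act ⊗≫ 𝟙 _ := by
      rw [h₂]
      bicategory
    _ = _ := by
      rw [← whisker_exchange]
      bicategory

/-- The restriction of an oplax action along a morphism of skew structures is an oplax action. -/
lemma IsOplaxAction.restrict (ha : a.IsOplaxAction)
    (hα : assocCell ≫ (κ ⊠₂ 𝟙 (𝟙 M.obj)) ▷ n ≫ M.mul ⊠₁ 𝟙 M.obj ◁ κ =
      as M.obj M.obj M.obj ◁ (𝟙 (𝟙 M.obj) ⊠₂ κ) ▷ n ≫
        as M.obj M.obj M.obj ◁ 𝟙 M.obj ⊠₁ M.mul ◁ κ ≫ M.assocCell)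
    (hl : leftCell ≫ M.one ⊠₁ 𝟙 M.obj ◁ κ = M.leftCell)
    (hr : 𝟙 M.obj ⊠₁ M.one ◁ κ ≫ M.rightCell = rightCell) :
    (a.restrict κ assocCell leftCell rightCell).IsOplaxAction where
  pentagon := by
    rw [restrict_pentagonLeft, restrict_pentagonRight _ _ _ _ _ hα, ha.pentagon]
  rightUnit := by
    rw [restrict_rightUnitLeft _ _ _ _ _ hr, restrict_rightUnitRight, ha.rightUnit]
  triangle := by
    rw [restrict_triangleLeft _ _ _ _ _ hl, ha.triangle]
    rfl

end OplaxActionData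

end Restriction

/-! ### Moving a counit across interchange, associativity and right unit constraints. -/

section TensorCounit

variable {B : Type u} [Bicategory.{w, v} B]

lemma rcomp_leftUnitor [TensorBicategory B] {X Y : B} (f : X ⟶ Y) (A : B) :
    (rcomp (𝟙 X) f A).hom ≫ (tensorId X A).hom ▷ (f ⊠₁ 𝟙 A) ≫ (λ_ (f ⊠₁ 𝟙 A)).hom =
      (λ_ f).hom ⊠₂ 𝟙 (𝟙 A) := by
  simp only [rcomp, Iso.trans_hom, tensorIso_hom, Category.assoc, tensorComp_hom_leftUnitor,
    ← tensorHom₂_comp]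
  simp

/-- `interchange_tensorCounit` solved for the whiskered counit, so that it can be rewritten inside a
larger pasting; the next two lemmas do the same for the other constraints. -/
lemma whiskerLeft_tensorCounit [TensorBicategory B] {X X' Y Y' : B} {f : X ⟶ X'} {g : X' ⟶ X}
    (e : g ≫ f ⟶ 𝟙 X') (h : Y ⟶ Y') :
    𝟙 X' ⊠₁ h ◁ tensorCounit e Y' = 𝟙 _ ⊗≫ (interchange g h).inv ▷ (f ⊠₁ 𝟙 Y') ⊗≫
      g ⊠₁ 𝟙 Y ◁ (interchange f h).inv ⊗≫ tensorCounit e Y ▷ (𝟙 X' ⊠₁ h) ⊗≫ 𝟙 _ := by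
  have H := interchange_tensorCounit e h
  calc
    _ = 𝟙 _ ⊗≫ (interchange g h).inv ▷ (f ⊠₁ 𝟙 Y') ⊗≫ g ⊠₁ 𝟙 Y ◁ (interchange f h).inv ≫
          (g ⊠₁ 𝟙 Y ◁ (interchange f h).hom ≫ (α_ _ _ _).inv ≫
            (interchange g h).hom ▷ (f ⊠₁ 𝟙 Y') ≫ (α_ _ _ _).hom ≫
              𝟙 X' ⊠₁ h ◁ tensorCounit e Y' ≫ (ρ_ _).hom) ⊗≫ 𝟙 _ := by
      simp [bicategoricalComp]
    _ = _ := by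
      rw [H]
      bicategory

variable [MonoidalBicategory B]

open MonoidalBicategoryStruct

lemma as_whiskerLeft_tensorCounit {X X' : B} {f : X ⟶ X'} {g : X' ⟶ X} (e : g ≫ f ⟶ 𝟙 X')
    (Y Z : B) :
    as X' Y Z ◁ tensorCounit e (Y ⊠ Z) =
      𝟙 _ ⊗≫ (assocNat₁ g Y Z).inv ▷ (f ⊠₁ 𝟙 (Y ⊠ Z)) ⊗≫
        (g ⊠₁ 𝟙 Y) ⊠₁ 𝟙 Z ◁ (assocNat₁ f Y Z).inv ⊗≫
          tensorCounit (tensorCounit e Y) Z ▷ as X' Y Z ⊗≫ 𝟙 _ := by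
  have H := assocNat₁_tensorCounit e Y Z
  calc
    _ = 𝟙 _ ⊗≫ (assocNat₁ g Y Z).inv ▷ (f ⊠₁ 𝟙 (Y ⊠ Z)) ⊗≫
          (g ⊠₁ 𝟙 Y) ⊠₁ 𝟙 Z ◁ (assocNat₁ f Y Z).inv ≫
          ((g ⊠₁ 𝟙 Y) ⊠₁ 𝟙 Z ◁ (assocNat₁ f Y Z).hom ≫ (α_ _ _ _).inv ≫
            (assocNat₁ g Y Z).hom ▷ (f ⊠₁ 𝟙 (Y ⊠ Z)) ≫ (α_ _ _ _).hom ≫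
              as X' Y Z ◁ tensorCounit e (Y ⊠ Z) ≫ (ρ_ _).hom) ⊗≫ 𝟙 _ := by
      simp [bicategoricalComp]
    _ = _ := by
      rw [H]
      bicategory

lemma tensorCounit_whiskerRight_ru {X X' : B} {f : X ⟶ X'} {g : X' ⟶ X} (e : g ≫ f ⟶ 𝟙 X') :
    tensorCounit e (tensorI B) ▷ ru X' =
      𝟙 _ ⊗≫ g ⊠₁ 𝟙 (tensorI B) ◁ (rightNat f).hom ⊗≫ (rightNat g).hom ▷ f ⊗≫ ru X' ◁ e ⊗≫
        𝟙 _ := by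
  have H := rightNat_tensorCounit e
  calc
    _ = 𝟙 _ ⊗≫ ((α_ _ _ _).inv ≫ tensorCounit e (tensorI B) ▷ ru X' ≫ (λ_ _).hom) ⊗≫ 𝟙 _ := by
      bicategory
    _ = _ := by
      rw [← H]
      bicategory

end TensorCounit

/-! ### The mate `κ` as a morphism of skew structures. -/

section Mate

variable {B : Type u} [Bicategory.{w, v} B] [MonoidalBicategory B]

open MonoidalBicategoryStruct MonoidalBicategory

namespace RightSkewMonoidaleData

variable (S : RightSkewMonoidaleData B) {i' : S.obj ⟶ tensorI B} (adj : S.one ⊣ i')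

lemma mate_eq : S.mate adj =
    i' ⊠₁ 𝟙 S.obj ◁ S.leftCell ≫ (α_ _ _ _).inv ≫ tensorCounit adj.counit S.obj ▷ S.mul ≫
      (λ_ _).hom := by
  rw [mate, Adjunction.homEquiv₁_apply, adjTensorRight_counit, tensorCounit]

/-- The left side is the inverse mate correspondence applied to `κ`, which returns `λ`. -/
lemma inducedSkew_leftCell_comp_mate :
    (inducedSkew adj).leftCell ≫ S.one ⊠₁ 𝟙 S.obj ◁ S.mate adj = S.leftCell := by
  have h := (adjTensorRight adj S.obj).homEquiv₁.symm_apply_apply S.leftCell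
  rw [Adjunction.homEquiv₁_symm_apply] at h
  simp only [inducedSkew, mate]
  exact Category.assoc _ _ _ |>.trans ((congrArg _ (Category.assoc _ _ _)).trans h)

/-- With `κ` expanded as `λ` then `ε1`, moving the counit past `1i` exposes the composite `u ⟶ uu ⟶
u` whiskered by `i*`. The unit axiom makes it a constraint cell, and only `ε` survives. -/
lemma mate_comp_rightCell (hu : S.unitLeft = S.unitRight) :
    𝟙 S.obj ⊠₁ S.one ◁ S.mate adj ≫ S.rightCell = (inducedSkew adj).rightCell := by
  rw [mate_eq]
  obtain ⟨R, m, u, α, l, r⟩ := S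
  dsimp only at *
  simp only [inducedSkew]
  simp only [unitLeft, unitRight] at hu
  generalize adj.counit = e at *
  calc
    _ = 𝟙 _ ⊗≫ (𝟙 R ⊠₁ u ≫ i' ⊠₁ 𝟙 R) ◁ l ⊗≫ (𝟙 R ⊠₁ u ◁ tensorCounit e R) ▷ m ⊗≫ r := by
      bicategory
    _ = 𝟙 _ ⊗≫ ((𝟙 R ⊠₁ u ≫ i' ⊠₁ 𝟙 R) ◁ l ≫ (interchange i' u).inv ▷ (u ⊠₁ 𝟙 R ≫ m)) ⊗≫
          i' ⊠₁ 𝟙 (tensorI B) ◁ (interchange u u).inv ▷ m ⊗≫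
          (tensorCounit e (tensorI B) ▷ (𝟙 R ⊠₁ u ≫ m) ≫ 𝟙 (R ⊠ tensorI B) ◁ r) ⊗≫ 𝟙 _ := by
      rw [whiskerLeft_tensorCounit]
      bicategory
    -- Two exchanges gather `λ`, the interchange and `ρ` into exactly the left side of `hu`.
    _ = 𝟙 _ ⊗≫ (interchange i' u).inv ▷ lu R ⊗≫
          i' ⊠₁ 𝟙 (tensorI B) ◁ (𝟙 (tensorI B) ⊠₁ u ◁ l ⊗≫ (interchange u u).inv ▷ m ⊗≫
            u ⊠₁ 𝟙 (tensorI B) ◁ r) ⊗≫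
          tensorCounit e (tensorI B) ▷ ru R ⊗≫ 𝟙 _ := by
      rw [whisker_exchange, ← whisker_exchange (tensorCounit e (tensorI B)) r]
      bicategory
    _ = 𝟙 _ ⊗≫ (interchange i' u).inv ▷ lu R ⊗≫
          i' ⊠₁ 𝟙 (tensorI B) ◁ (leftNat u).hom ⊗≫ i' ⊠₁ 𝟙 (tensorI B) ◁ (unitIso B).hom ▷ u ⊗≫
          i' ⊠₁ 𝟙 (tensorI B) ◁ ((rightNat u).inv ≫ (rightNat u).hom) ⊗≫
          (rightNat i').hom ▷ u ⊗≫ ru R ◁ e ⊗≫ 𝟙 _ := by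
      rw [hu, tensorCounit_whiskerRight_ru]
      bicategory
    _ = _ := by
      rw [Iso.inv_hom_id]
      bicategory

/-- Tensoring with `R` on the right preserves the formula for the mate: `κ1` is `λ1` followed by the
twice-tensored counit. This is the shape in which the associator computation meets `κ1`. -/
lemma rcomp_inv_comp_mate :
    (rcomp (i' ⊠₁ 𝟙 S.obj) (lu S.obj) S.obj).inv ≫ S.mate adj ⊠₂ 𝟙 (𝟙 S.obj) =
      (i' ⊠₁ 𝟙 S.obj) ⊠₁ 𝟙 S.obj ◁ (S.leftCell ⊠₂ 𝟙 (𝟙 S.obj) ≫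
        (rcomp (S.one ⊠₁ 𝟙 S.obj) S.mul S.obj).hom) ⊗≫
      tensorCounit (tensorCounit adj.counit S.obj) S.obj ▷ (S.mul ⊠₁ 𝟙 S.obj) ⊗≫ 𝟙 _ := by
  have h₁ := rcomp_associator (i' ⊠₁ 𝟙 S.obj) (S.one ⊠₁ 𝟙 S.obj) S.mul S.obj
  have h₂ := rcomp_leftUnitor S.mul S.obj
  have h₁' : (rcomp (i' ⊠₁ 𝟙 S.obj) (S.one ⊠₁ 𝟙 S.obj ≫ S.mul) S.obj).inv ≫
      (α_ _ _ _).inv ⊠₂ 𝟙 (𝟙 S.obj) =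
      (i' ⊠₁ 𝟙 S.obj) ⊠₁ 𝟙 S.obj ◁ (rcomp (S.one ⊠₁ 𝟙 S.obj) S.mul S.obj).hom ≫
      (α_ _ _ _).inv ≫ (rcomp (i' ⊠₁ 𝟙 S.obj) (S.one ⊠₁ 𝟙 S.obj) S.obj).inv ▷ _ ≫
      (rcomp (i' ⊠₁ 𝟙 S.obj ≫ S.one ⊠₁ 𝟙 S.obj) S.mul S.obj).inv := by
    rw [← cancel_mono (rcomp (i' ⊠₁ 𝟙 S.obj ≫ S.one ⊠₁ 𝟙 S.obj) S.mul S.obj).hom,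
      ← cancel_mono ((rcomp (i' ⊠₁ 𝟙 S.obj) (S.one ⊠₁ 𝟙 S.obj) S.obj).hom ▷ (S.mul ⊠₁ 𝟙 S.obj)),
      ← cancel_mono (α_ _ _ _).hom]
    conv_lhs => simp only [Category.assoc, h₁]
    simp [← reassoc_of% @tensorHom₂_id_comp, tensorHom₂_id]
  have h₂' : (rcomp (𝟙 (S.obj ⊠ S.obj)) S.mul S.obj).inv ≫ (λ_ S.mul).hom ⊠₂ 𝟙 (𝟙 S.obj) =
      (tensorId (S.obj ⊠ S.obj) S.obj).hom ▷ (S.mul ⊠₁ 𝟙 S.obj) ≫ (λ_ _).hom := by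
    rw [← h₂, Iso.inv_hom_id_assoc]
  have h₃ : tensorCounit (tensorCounit adj.counit S.obj) S.obj =
      (rcomp _ _ S.obj).inv ≫ tensorCounit adj.counit S.obj ⊠₂ 𝟙 (𝟙 S.obj) ≫
        (tensorId _ S.obj).hom := rfl
  rw [mate_eq, h₃]
  simp only [tensorHom₂_id_comp, reassoc_of% @rcomp_inv_naturality_right, reassoc_of% h₁',
    reassoc_of% @rcomp_inv_naturality_left, h₂']
  bicategory

/-- Expanding the outer `κ` on the right side puts `λ` before `α`. The left unit axiom replaces that
pair by `λ1`, which with the displaced counit is `κ1`; the constraints crossed on the way make up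
the induced associator. -/
lemma inducedSkew_assocCell_comp_mate (hl : S.leftUnitLeft = S.leftUnitRight) :
    (inducedSkew adj).assocCell ≫ (S.mate adj ⊠₂ 𝟙 (𝟙 S.obj)) ▷ (i' ⊠₁ 𝟙 S.obj ≫ lu S.obj) ≫
        S.mul ⊠₁ 𝟙 S.obj ◁ S.mate adj =
      as S.obj S.obj S.obj ◁ (𝟙 (𝟙 S.obj) ⊠₂ S.mate adj) ▷ (i' ⊠₁ 𝟙 S.obj ≫ lu S.obj) ≫
        as S.obj S.obj S.obj ◁ 𝟙 S.obj ⊠₁ S.mul ◁ S.mate adj ≫ S.assocCell := by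
  have hκ := S.mate_eq adj
  have hκ₁ := S.rcomp_inv_comp_mate adj
  obtain ⟨R, m, u, α, l, r⟩ := S
  dsimp only at *
  simp only [inducedSkew]
  simp only [leftUnitLeft, leftUnitRight] at hl
  generalize mate _ adj = κ at *
  generalize adj.counit = e at *
  dsimp only at κ e
  have hI : (𝟙 (𝟙 R) ⊠₂ κ) ▷ (i' ⊠₁ 𝟙 R) ≫ (interchange i' m).inv =
      (interchange i' (i' ⊠₁ 𝟙 R ≫ lu R)).inv ≫
        i' ⊠₁ 𝟙 (R ⊠ R) ◁ (𝟙 (𝟙 (tensorI B)) ⊠₂ κ) := by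
    rw [Iso.eq_inv_comp, ← Category.assoc, ← interchange_naturality_right]
    simp
  have hL := leftNat_natural κ
  generalize (l ⊠₂ 𝟙 (𝟙 R) ≫ (rcomp (u ⊠₁ 𝟙 R) m R).hom) = y at *
  symm
  calc
    _ = 𝟙 _ ⊗≫ as R R R ◁ (𝟙 (𝟙 R) ⊠₂ κ) ▷ (i' ⊠₁ 𝟙 R ≫ lu R) ⊗≫
          (as R R R ≫ 𝟙 R ⊠₁ m ≫ i' ⊠₁ 𝟙 R) ◁ l ⊗≫
          as R R R ◁ (𝟙 R ⊠₁ m ◁ tensorCounit e R) ▷ m ⊗≫ α := by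
      -- Only the outer `κ` is expanded; the inner one, in `1κ`, is carried along intact and becomes
      -- the remaining `κ` of the target.
      nth_rw 2 [hκ]
      bicategory
    _ = 𝟙 _ ⊗≫ as R R R ◁ (𝟙 (𝟙 R) ⊠₂ κ) ▷ (i' ⊠₁ 𝟙 R ≫ lu R) ⊗≫
          as R R R ◁ ((𝟙 R ⊠₁ m ≫ i' ⊠₁ 𝟙 R) ◁ l ≫
            (interchange i' m).inv ▷ (u ⊠₁ 𝟙 R ≫ m)) ⊗≫
          as R R R ◁ i' ⊠₁ 𝟙 (R ⊠ R) ◁ (interchange u m).inv ▷ m ⊗≫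
          (as R R R ◁ tensorCounit e (R ⊠ R)) ▷ (𝟙 R ⊠₁ m ≫ m) ⊗≫ α := by
      rw [whiskerLeft_tensorCounit]
      bicategory
    _ = 𝟙 _ ⊗≫ as R R R ◁ ((𝟙 (𝟙 R) ⊠₂ κ) ▷ (i' ⊠₁ 𝟙 R) ≫ (interchange i' m).inv) ▷ lu R ⊗≫
          ((as R R R ≫ i' ⊠₁ 𝟙 (R ⊠ R)) ◁
            (𝟙 (tensorI B) ⊠₁ m ◁ l ⊗≫ (interchange u m).inv ▷ m ⊗≫ 𝟙 _) ≫
          (assocNat₁ i' R R).inv ▷ (u ⊠₁ 𝟙 (R ⊠ R) ≫ 𝟙 R ⊠₁ m ≫ m)) ⊗≫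
          (i' ⊠₁ 𝟙 R) ⊠₁ 𝟙 R ◁ (assocNat₁ u R R).inv ▷ (𝟙 R ⊠₁ m ≫ m) ⊗≫
          (tensorCounit (tensorCounit e R) R ▷ (as R R R ≫ 𝟙 R ⊠₁ m ≫ m) ≫ _ ◁ α) ⊗≫ 𝟙 _ := by
      rw [whisker_exchange, as_whiskerLeft_tensorCounit]
      bicategory
    _ = 𝟙 _ ⊗≫ as R R R ◁ ((interchange i' (i' ⊠₁ 𝟙 R ≫ lu R)).inv ≫
            i' ⊠₁ 𝟙 (R ⊠ R) ◁ (𝟙 (𝟙 (tensorI B)) ⊠₂ κ)) ▷ lu R ⊗≫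
          (assocNat₁ i' R R).inv ▷ (𝟙 (tensorI B) ⊠₁ m ≫ lu R) ⊗≫
          -- An inserted inverse pair: the second cell begins the left unit composite, while the
          -- first lets `κ` pass through `l` by naturality.
          (i' ⊠₁ 𝟙 R) ⊠₁ 𝟙 R ◁ as (tensorI B) R R ◁ ((leftNat m).hom ≫ (leftNat m).inv) ⊗≫
          (i' ⊠₁ 𝟙 R) ⊠₁ 𝟙 R ◁ (as (tensorI B) R R ≫ 𝟙 (tensorI B) ⊠₁ m) ◁ l ⊗≫
          (i' ⊠₁ 𝟙 R) ⊠₁ 𝟙 R ◁ as (tensorI B) R R ◁ (interchange u m).inv ▷ m ⊗≫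
          (i' ⊠₁ 𝟙 R) ⊠₁ 𝟙 R ◁ (assocNat₁ u R R).inv ▷ (𝟙 R ⊠₁ m ≫ m) ⊗≫
          (i' ⊠₁ 𝟙 R) ⊠₁ 𝟙 R ◁ (u ⊠₁ 𝟙 R) ⊠₁ 𝟙 R ◁ α ⊗≫
          tensorCounit (tensorCounit e R) R ▷ (m ⊠₁ 𝟙 R ≫ m) ⊗≫ 𝟙 _ := by
      rw [hI, whisker_exchange, ← whisker_exchange (tensorCounit (tensorCounit e R) R) α,
        Iso.hom_inv_id]
      bicategory
    _ = 𝟙 _ ⊗≫ as R R R ◁ (interchange i' (i' ⊠₁ 𝟙 R ≫ lu R)).inv ▷ lu R ⊗≫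
          ((as R R R ≫ i' ⊠₁ 𝟙 (R ⊠ R)) ◁ (𝟙 (𝟙 (tensorI B)) ⊠₂ κ) ≫
          (assocNat₁ i' R R).inv ▷ (𝟙 (tensorI B) ⊠₁ m)) ▷ lu R ⊗≫
          (i' ⊠₁ 𝟙 R) ⊠₁ 𝟙 R ◁ as (tensorI B) R R ◁ (leftNat m).hom ⊗≫
          (i' ⊠₁ 𝟙 R) ⊠₁ 𝟙 R ◁ (as (tensorI B) R R ◁ (leftNat m).inv ⊗≫
            (as (tensorI B) R R ≫ 𝟙 (tensorI B) ⊠₁ m) ◁ l ⊗≫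
            as (tensorI B) R R ◁ (interchange u m).inv ▷ m ⊗≫
            (assocNat₁ u R R).inv ▷ (𝟙 R ⊠₁ m ≫ m) ⊗≫
            (u ⊠₁ 𝟙 R) ⊠₁ 𝟙 R ◁ α) ⊗≫
          tensorCounit (tensorCounit e R) R ▷ (m ⊠₁ 𝟙 R ≫ m) ⊗≫ 𝟙 _ := by
      bicategory
    _ = 𝟙 _ ⊗≫ as R R R ◁ (interchange i' (i' ⊠₁ 𝟙 R ≫ lu R)).inv ▷ lu R ⊗≫
          (assocNat₁ i' R R).inv ▷ (𝟙 (tensorI B) ⊠₁ (i' ⊠₁ 𝟙 R ≫ lu R) ≫ lu R) ⊗≫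
          (i' ⊠₁ 𝟙 R) ⊠₁ 𝟙 R ◁ as (tensorI B) R R ◁
            ((𝟙 (𝟙 (tensorI B)) ⊠₂ κ) ▷ lu R ≫ (leftNat m).hom) ⊗≫
          (i' ⊠₁ 𝟙 R) ⊠₁ 𝟙 R ◁ (leftUnit R R).inv ▷ m ⊗≫
          (i' ⊠₁ 𝟙 R) ⊠₁ 𝟙 R ◁ y ▷ m ⊗≫
          tensorCounit (tensorCounit e R) R ▷ (m ⊠₁ 𝟙 R ≫ m) ⊗≫ 𝟙 _ := by
      rw [hl, whisker_exchange]
      bicategory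
    _ = 𝟙 _ ⊗≫ as R R R ◁ (interchange i' (i' ⊠₁ 𝟙 R ≫ lu R)).inv ▷ lu R ⊗≫
          (assocNat₁ i' R R).inv ▷ (𝟙 (tensorI B) ⊠₁ (i' ⊠₁ 𝟙 R ≫ lu R) ≫ lu R) ⊗≫
          (i' ⊠₁ 𝟙 R) ⊠₁ 𝟙 R ◁ as (tensorI B) R R ◁ (leftNat (i' ⊠₁ 𝟙 R ≫ lu R)).hom ⊗≫
          ((i' ⊠₁ 𝟙 R) ⊠₁ 𝟙 R ≫ as (tensorI B) R R ≫ lu (R ⊠ R)) ◁ κ ⊗≫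
          ((i' ⊠₁ 𝟙 R) ⊠₁ 𝟙 R ◁ (leftUnit R R).inv ⊗≫
            (i' ⊠₁ 𝟙 R) ⊠₁ 𝟙 R ◁ y ⊗≫
            tensorCounit (tensorCounit e R) R ▷ (m ⊠₁ 𝟙 R) ⊗≫ 𝟙 (m ⊠₁ 𝟙 R)) ▷ m ⊗≫ 𝟙 _ := by
      rw [hL]
      bicategory
    _ = 𝟙 _ ⊗≫ as R R R ◁ (interchange i' (i' ⊠₁ 𝟙 R ≫ lu R)).inv ▷ lu R ⊗≫
          (assocNat₁ i' R R).inv ▷ (𝟙 (tensorI B) ⊠₁ (i' ⊠₁ 𝟙 R ≫ lu R) ≫ lu R) ⊗≫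
          (i' ⊠₁ 𝟙 R) ⊠₁ 𝟙 R ◁ as (tensorI B) R R ◁ (leftNat (i' ⊠₁ 𝟙 R ≫ lu R)).hom ⊗≫
          (((i' ⊠₁ 𝟙 R) ⊠₁ 𝟙 R ≫ as (tensorI B) R R ≫ lu (R ⊠ R)) ◁ κ ≫
          ((i' ⊠₁ 𝟙 R) ⊠₁ 𝟙 R ◁ (leftUnit R R).inv ⊗≫
            ((rcomp (i' ⊠₁ 𝟙 R) (lu R) R).inv ≫ κ ⊠₂ 𝟙 (𝟙 R))) ▷ m) ⊗≫ 𝟙 _ := by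
      -- Read from the new line to the old: `λ1` and the twice-tensored counit are reassembled into
      -- `κ1`.
      rw [hκ₁]
      bicategory
    _ = _ := by
      rw [whisker_exchange]
      bicategory

end RightSkewMonoidaleData

end Mate

end MonBicat

theorem mainTheorem12 {B : Type u} [Bicategory.{w, v} B] [MonoidalBicategory B]
    (S : RightSkewMonoidale B) (i' : S.obj ⟶ tensorI B) (adj : S.one ⊣ i') :
    (S.underlyingAction adj).IsOplaxAction :=
  -- The action in the statement is definitionally this restriction, with the cells of the induced
  -- skew structure filling the placeholders.
  OplaxActionData.IsOplaxAction.restrict S.regular (S.mate adj) _ _ _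
    ⟨S.pentagon, S.rightUnit, S.triangle⟩
    (S.inducedSkew_assocCell_comp_mate adj S.leftUnit)
    (S.inducedSkew_leftCell_comp_mate adj)
    (S.mate_comp_rightCell adj S.unit)
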